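/- \textbf{Theorem (No rate penalty for a Gaussian source).} Let $(X,S)$ be jointly Gaussian real random variables with $X\sim\mathcal N(\mu_X,\sigma_X^2)$, $S\sim\mathcal N(\mu_S,\sigma_S^2)$, $\sigma_X,\sigma_S>0$, and $\mathrm{Cov}(X,S)=\theta_1$. All variables generated from $X$ through a conditional distribution are conditionally independent of $S$ given $X$. Let $I$ denote mutual information (with values in $[0,\infty]$), and let $H(S\mid \hat X)$ denote conditional differential entropy (equal to $-\infty$ when the conditional law of $S$ given $\hat X$ fails to have a density with positive probability), all in nats. For $(D,C)\in\mathbb R^2$ put $$R(D,C)=\inf\bigl\{I(X;\hat X):\ p_{\hat X|X},\ \hat X\in\mathbb R,\ \mathbb E[(X-\hat X)^2]\le D,\ H(S\mid\hat X)\le C\bigr\}\in[0,\infty]\qquad(\inf\emptyset=\infty),$$ and $\Omega(R)=\{(D,C): R(D,C)\le R\}$. For a representation $Z$ of $X$, generated through a conditional distribution $p_{Z|X}$, let $\Omega(p_{Z|X})$ be the set of $(D,C)\in\mathbb R^2$ for which there is a decoder $p_{\hat X|Z}$ (with $S\to X\to Z\to\hat X$ a Markov chain) such that $\mathbb E[(X-\hat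 X)^2]\le D$ and $H(S\mid\hat X)\le C$. For a non-empty set $\Theta\subseteq\mathbb R^2$ of constraint pairs, let $$R(\Theta)=\inf\{I(X;Z):\ p_{Z|X},\ \Theta\subseteq\Omega(p_{Z|X})\},\qquad A(\Theta)=R(\Theta)-\sup_{(D,C)\in\Theta}R(D,C).$$ Then for every non-empty $\Theta\subseteq\mathbb R^2$ $$R(\Theta)=\sup_{(D,C)\in\Theta}R(D,C)\quad\text{in }[0,\infty].$$ If moreover $\sup_{(D,C)\in\Theta}R(D,C)<\infty$, then: (i) $A(\Theta)=0$; (ii) for every representation $Z$ of $X$ with values in a finite-dimensional real normed space $E$ such that $(X,Z)$ is jointly Gaussian and $I(X;Z)=\sup_{(D,C)\in\Theta}R(D,C)$, $$\Theta\subseteq\Omega(p_{Z|X})=\Omega(I(X;Z));$$ (iii) for every $Z$ as in (ii) and every $(D,C)\in\Omega(I(X;Z))$, there is a linear map $\ell:E\to\mathbb R$ such that $\hat X=\ell(Z-\mathbb E[Z])+\mu_X$ satisfies $\mathbb E[(X-\hat X)^2]\le D$ and $H(S\mid\hat X)\le C$. For scalar $Z$ this is a scaled linear decoder $\hat X=\gamma(Z-\mathbb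 E[Z])+\mu_X$ with $\gamma\in\mathbb R$. -/

import Mathlib

open MeasureTheory ProbabilityTheory
open scoped ENNReal

noncomputable section

namespace RDC

/-- Mutual information `I(A; B)` (in nats) of a pair `(A, B)` with joint law `π`: the
Kullback–Leibler divergence of `π` from the product of its marginals, valued in `[0, ∞]`. -/
def mutualInfo {α β : Type*} [MeasurableSpace α] [MeasurableSpace β]
    (π : Measure (α × β)) : ℝ≥0∞ :=
  InformationTheory.klDiv π (π.fst.prod π.snd)

/-- The conditional density `f(s | y)` of `S` given `Y`, for a pair `(Y, S)` with joint law `π`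
and a real-valued `S`: the density of `π` with respect to `P_Y ⊗ Lebesgue`. -/
def condDensity {β : Type*} [MeasurableSpace β] (π : Measure (β × ℝ)) (q : β × ℝ) : ℝ :=
  (π.rnDeriv (π.fst.prod volume) q).toReal

open Classical in
/-- Conditional differential entropy `H(S | Y) = - E[log f(S | Y)]` (in nats) of a real-valued `S`
given `Y`, for a pair `(Y, S)` with joint law `π`. It is the extended real number
`E[(log f)⁻] - E[(log f)⁺]`, and it is `-∞` if the conditional law of `S` given `Y` fails to have a
density with positive probability. -/
def condEntropy {β : Type*} [MeasurableSpace β] (π : Measure (β × ℝ)) : EReal :=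
  if π ≪ π.fst.prod volume then
    ((∫⁻ q, ENNReal.ofReal (-Real.log (condDensity π q)) ∂π : ℝ≥0∞) : EReal)
      - ((∫⁻ q, ENNReal.ofReal (Real.log (condDensity π q)) ∂π : ℝ≥0∞) : EReal)
  else ⊥

/-- The joint law of the pair `(X, S)`. -/
def jointLaw {Ω : Type*} [MeasurableSpace Ω] (P : Measure Ω) (X S : Ω → ℝ) : Measure (ℝ × ℝ) :=
  P.map (fun ω => (X ω, S ω))

/-! Below, `ν` is the joint law of `(X, S)`, so that `ν.fst` is the law of `X`. A Markov kernel `κ`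
out of `ℝ` is a conditional distribution `p_{Z|X}`; the variable it generates is conditionally
independent of `S` given `X`. -/

/-- The joint law of `(X, Z)`, where `Z` is generated from `X` through `κ = p_{Z|X}`. -/
def lawSourceRep {β : Type*} [MeasurableSpace β] (ν : Measure (ℝ × ℝ)) (κ : Kernel ℝ β) :
    Measure (ℝ × β) :=
  ν.fst ⊗ₘ κ

/-- The joint law of `(Z, S)`, where `Z` is generated from `X` through `κ = p_{Z|X}`, so that
`S → X → Z` is a Markov chain. -/
def lawRepClass {β : Type*} [MeasurableSpace β] (ν : Measure (ℝ × ℝ)) (κ : Kernel ℝ β) :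
    Measure (β × ℝ) :=
  (ν ⊗ₘ (κ.comap Prod.fst measurable_fst)).map (fun q => (q.2, q.1.2))

/-- Mean squared error `E[(X - X̂)²]` of the reconstruction `X̂` generated by `κ = p_{X̂|X}`. -/
def mse (ν : Measure (ℝ × ℝ)) (κ : Kernel ℝ ℝ) : ℝ≥0∞ :=
  ∫⁻ q, ENNReal.ofReal ((q.1 - q.2) ^ 2) ∂(lawSourceRep ν κ)

/-- The reconstruction generated by `κ = p_{X̂|X}` meets the constraint pair `(D, C)`:
`E[(X - X̂)²] ≤ D` and `H(S | X̂) ≤ C`. -/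
def Meets (ν : Measure (ℝ × ℝ)) (κ : Kernel ℝ ℝ) (D C : ℝ) : Prop :=
  ((mse ν κ : ℝ≥0∞) : EReal) ≤ (D : EReal) ∧ condEntropy (lawRepClass ν κ) ≤ (C : EReal)

/-- The information rate-distortion-classification function `R(D, C)`, equal to `∞` if no
conditional distribution meets the constraints. -/
def rate (ν : Measure (ℝ × ℝ)) (D C : ℝ) : ℝ≥0∞ :=
  ⨅ (κ : Kernel ℝ ℝ) (_ : IsMarkovKernel κ) (_ : Meets ν κ D C), mutualInfo (lawSourceRep ν κ)

/-- `Ω(R)`, the set of pairs `(D, C)` with `R(D, C) ≤ R`. -/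
def rateRegion (ν : Measure (ℝ × ℝ)) (R : ℝ≥0∞) : Set (ℝ × ℝ) :=
  {p | rate ν p.1 p.2 ≤ R}

/-- `Ω(p_{Z|X})`, the set of pairs `(D, C)` that are met by applying some decoder `δ = p_{X̂|Z}`
to the representation `Z`. -/
def repRegion {β : Type*} [MeasurableSpace β] (ν : Measure (ℝ × ℝ)) (κ : Kernel ℝ β) :
    Set (ℝ × ℝ) :=
  {p | ∃ δ : Kernel β ℝ, IsMarkovKernel δ ∧ Meets ν (δ ∘ₖ κ) p.1 p.2}

/-- The information universal rate-distortion-classification function `R(Θ)`: the infimum of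
`I(X; Z)` over all representations `Z` (with values in any measurable space) from which every
constraint pair in `Θ` can be met by a suitable decoder. -/
def universalRate (ν : Measure (ℝ × ℝ)) (Θ : Set (ℝ × ℝ)) : ℝ≥0∞ :=
  ⨅ (β : Type) (_ : MeasurableSpace β) (κ : Kernel ℝ β) (_ : IsMarkovKernel κ)
    (_ : Θ ⊆ repRegion ν κ), mutualInfo (lawSourceRep ν κ)

/-- `sup_{(D, C) ∈ Θ} R(D, C)`. -/
def supRate (ν : Measure (ℝ × ℝ)) (Θ : Set (ℝ × ℝ)) : ℝ≥0∞ :=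
  ⨆ p ∈ Θ, rate ν p.1 p.2

/-- The rate penalty `A(Θ) = R(Θ) - sup_{(D, C) ∈ Θ} R(D, C)`. -/
def ratePenalty (ν : Measure (ℝ × ℝ)) (Θ : Set (ℝ × ℝ)) : EReal :=
  (universalRate ν Θ : EReal) - (supRate ν Θ : EReal)

end RDC

end

/-! Let `v` be the variance of `X`. Gaussian regression gives `S = aX + b + N` with `N ∼ N(0, w)`
independent of `X`, and, by the Markov property, of `(X, X̂)`. If `I = I(X; X̂)` is finite, then
`E[(X - X̂)²] ≥ v e^{-2I}` and `H(S | X̂) ≥ ½ log(2πe (a² v e^{-2I} + w))`. The first is the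
Gaussian rate-distortion bound, the second a conditional entropy power inequality with one Gaussian
summand. Both bounds are non-increasing in `I`, and both are attained at once by the backward
channel `X = g(Z) + N'`, `X̂ = g(Z)`, with Gaussian `N'` of variance `t = v e^{-2I}`. So for finite
`R` the region `Ω(R)` is a quadrant whose corner is reached by one channel of rate `R`: at fixed
rate there is no tradeoff between distortion and classification, and a channel of rate `sup R(D, C)`
serves all of `Θ`. The converse inequality is data processing. A jointly Gaussian representation is
always such a backward channel, with `g` affine (`exists_eq_testChannel`).

The entropy power inequality is proved in a dual form, `lintegral_exp_integral_log_le`, which bounds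
`∫ exp(E[log p(y + N)] / l) dy` over densities `p`. An increasing map carries the normalised
integrand to the standard Gaussian law; a change of variables modelled on a rotation of two
independent Gaussians, Jensen's inequality and concavity of the logarithm do the rest. A
Donsker–Varadhan inequality, `integrable_and_integral_le_klDiv`, converts the dual form into the
entropy bound `le_condEntropy_repLaw`; with a Gaussian test function it also yields
`ofReal_le_lintegral_sq_sub`. -/

namespace RDC

/-! ### Monotone transport to the standard Gaussian law. -/

section Transport

open Set Filter Topology
open scoped NNReal

lemma hasDerivAt_cdf_gaussianReal (v : ℝ) :
    HasDerivAt (cdf (gaussianReal 0 1)) (gaussianPDFReal 0 1 v) v := by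
  have hcont : Continuous (gaussianPDFReal 0 1) := by
    rw [gaussianPDFReal_def]; fun_prop
  have hint : Integrable (gaussianPDFReal 0 1) := integrable_gaussianPDFReal 0 1
  have hform : ∀ x, cdf (gaussianReal 0 1) x
      = ∫ t in Iic x, gaussianPDFReal 0 1 t := by
    intro x
    rw [cdf_eq_real, measureReal_def, gaussianReal_apply_eq_integral _ one_ne_zero,
      ENNReal.toReal_ofReal]
    exact setIntegral_nonneg measurableSet_Iic fun t _ => gaussianPDFReal_nonneg _ _ _
  have heq : (cdf (gaussianReal 0 1) : ℝ → ℝ)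
      = fun x => cdf (gaussianReal 0 1) 0 + ∫ t in (0 : ℝ)..x, gaussianPDFReal 0 1 t := by
    ext x
    rw [← intervalIntegral.integral_Iic_sub_Iic hint.integrableOn hint.integrableOn,
      hform, hform]
    ring
  rw [heq]
  exact (intervalIntegral.integral_hasDerivAt_right (hcont.intervalIntegrable _ _)
    (hcont.stronglyMeasurableAtFilter _ _) hcont.continuousAt).const_add _

lemma strictMono_cdf_gaussianReal : StrictMono (cdf (gaussianReal 0 1)) :=
  strictMono_of_deriv_pos fun x => by
    rw [(hasDerivAt_cdf_gaussianReal x).deriv]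
    exact gaussianPDFReal_pos _ _ _ one_ne_zero

lemma exists_cdf_gaussianReal_eq {t : ℝ} (h0 : 0 < t) (h1 : t < 1) :
    ∃ v, cdf (gaussianReal 0 1) v = t := by
  have hcont : Continuous (cdf (gaussianReal 0 1)) :=
    continuous_iff_continuousAt.2 fun x => (hasDerivAt_cdf_gaussianReal x).continuousAt
  refine mem_range_of_exists_le_of_exists_ge hcont ?_ ?_
  · exact (((tendsto_cdf_atBot _).eventually (gt_mem_nhds h0)).mono fun _ h => h.le).exists
  · exact (((tendsto_cdf_atTop _).eventually (lt_mem_nhds h1)).mono fun _ h => h.le).exists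

/-- The increasing map that transports a positive continuous density on an interval to the
standard Gaussian law, through the equation it satisfies. -/
lemma exists_gaussian_transport {q : ℝ → ℝ} (hq : Continuous q) (hpos : ∀ y, 0 < q y)
    {A B : ℝ} (hAB : A < B) :
    ∃ V : ℝ → ℝ, Measurable V ∧ ∀ y ∈ Ioo A B,
      HasDerivAt V (q y / ((∫ t in A..B, q t) * gaussianPDFReal 0 1 (V y))) y := by
  set Z := ∫ t in A..B, q t with hZ
  have hii : ∀ a b, IntervalIntegrable q volume a b := fun a b => hq.intervalIntegrable a b
  have hZpos : 0 < Z := intervalIntegral.intervalIntegral_pos_of_pos (hii _ _) hpos hAB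
  set F : ℝ → ℝ := fun y => (∫ t in A..y, q t) / Z with hF
  have hFd : ∀ y, HasDerivAt F (q y / Z) y := fun y =>
    (intervalIntegral.integral_hasDerivAt_right (hii _ _)
      (hq.stronglyMeasurableAtFilter _ _) hq.continuousAt).div_const Z
  have hFmem : ∀ y ∈ Ioo A B, 0 < F y ∧ F y < 1 := by
    intro y hy
    refine ⟨div_pos (intervalIntegral.intervalIntegral_pos_of_pos (hii _ _) hpos hy.1) hZpos, ?_⟩
    rw [hF, div_lt_one hZpos, hZ,
      ← intervalIntegral.integral_add_adjacent_intervals (hii A y) (hii y B)]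
    linarith [intervalIntegral.intervalIntegral_pos_of_pos (hii y B) hpos hy.2]
  -- The transport is `Ψ ∘ F`: `F` is the distribution function of the normalised density on `(A,
  -- B)`, and `Ψ` inverts the Gaussian one on `(0, 1)`, with an irrelevant value elsewhere.
  have hex : ∀ t, ∃ v, t ∈ Ioo (0 : ℝ) 1 → cdf (gaussianReal 0 1) v = t := by
    intro t
    by_cases ht : t ∈ Ioo (0 : ℝ) 1
    · obtain ⟨v, hv⟩ := exists_cdf_gaussianReal_eq ht.1 ht.2
      exact ⟨v, fun _ => hv⟩
    · exact ⟨0, fun h => absurd h ht⟩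
  choose Ψ hΨ using hex
  -- An interval as range makes the strictly increasing distribution function an embedding, so its
  -- inverse is continuous; the inverse function rule needs this.
  have hord : (range (cdf (gaussianReal 0 1))).OrdConnected := by
    have hcont : Continuous (cdf (gaussianReal 0 1)) :=
      continuous_iff_continuousAt.2 fun x => (hasDerivAt_cdf_gaussianReal x).continuousAt
    exact (isPreconnected_range hcont).ordConnected
  have hind := (strictMono_cdf_gaussianReal.isEmbedding_of_ordConnected hord).isInducing
  have hΨd : ∀ t ∈ Ioo (0 : ℝ) 1, HasDerivAt Ψ (gaussianPDFReal 0 1 (Ψ t))⁻¹ t := by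
    intro t ht
    have hev : ∀ᶠ z in 𝓝 t, cdf (gaussianReal 0 1) (Ψ z) = z := by
      filter_upwards [isOpen_Ioo.mem_nhds ht] with z hz using hΨ z hz
    refine HasDerivAt.of_local_left_inverse ?_ (hasDerivAt_cdf_gaussianReal _)
      (gaussianPDFReal_pos 0 1 _ one_ne_zero).ne' hev
    rw [hind.continuousAt_iff]
    exact continuousAt_id.congr (hev.mono fun z hz => hz.symm)
  have hVd : ∀ y ∈ Ioo A B,
      HasDerivAt (Ψ ∘ F) (q y / (Z * gaussianPDFReal 0 1 ((Ψ ∘ F) y))) y := by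
    intro y hy
    have h := (hΨd (F y) (hFmem y hy)).comp y (hFd y)
    have heq : (gaussianPDFReal 0 1 (Ψ (F y)))⁻¹ * (q y / Z)
        = q y / (Z * gaussianPDFReal 0 1 ((Ψ ∘ F) y)) := by
      rw [Function.comp_apply, div_mul_eq_div_div]
      ring
    rwa [heq] at h
  have hVc : ∀ y ∈ Ioo A B, ContinuousAt (Ψ ∘ F) y := fun y hy => (hVd y hy).continuousAt
  refine ⟨(Ioo A B).piecewise (Ψ ∘ F) 0, ?_, fun y hy => ?_⟩
  · refine ContinuousOn.measurable_piecewise ?_ continuousOn_const measurableSet_Ioo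
    exact fun y hy => (hVc y hy).continuousWithinAt
  · rw [piecewise_eq_of_mem _ _ _ hy]
    refine (hVd y hy).congr_of_eventuallyEq ?_
    filter_upwards [isOpen_Ioo.mem_nhds hy] with z hz using piecewise_eq_of_mem _ _ _ hz

end Transport

/-! ### Integrals against Gaussian laws. -/

section GaussianIntegrals

open Set Filter Topology
open scoped NNReal

lemma log_gaussianPDFReal (m : ℝ) {v : ℝ≥0} (hv : v ≠ 0) (x : ℝ) :
    Real.log (gaussianPDFReal m v x)
      = -(1 / 2) * Real.log (2 * Real.pi * v) - (x - m) ^ 2 / (2 * v) := by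
  have hv' : (0 : ℝ) < v := by positivity
  rw [gaussianPDFReal_def, Real.log_mul (by positivity) (Real.exp_pos _).ne', Real.log_exp,
    Real.log_inv, Real.log_sqrt (by positivity)]
  ring

lemma integrable_gaussianReal_iff {m : ℝ} {v : ℝ≥0} (hv : v ≠ 0) {f : ℝ → ℝ} :
    Integrable f (gaussianReal m v) ↔ Integrable (fun x => gaussianPDFReal m v x * f x) := by
  rw [gaussianReal_of_var_ne_zero _ hv,
    integrable_withDensity_iff_integrable_smul' (measurable_gaussianPDF _ _)
      (ae_of_all _ fun _ => gaussianPDF_lt_top)]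
  simp

lemma integrable_id_gaussianReal (m : ℝ) (v : ℝ≥0) :
    Integrable (fun x : ℝ => x) (gaussianReal m v) :=
  memLp_one_iff_integrable.1 (memLp_id_gaussianReal' 1 ENNReal.one_ne_top)

lemma integrable_sq_gaussianReal (m : ℝ) (v : ℝ≥0) :
    Integrable (fun x : ℝ => x ^ 2) (gaussianReal m v) :=
  (memLp_id_gaussianReal' 2 (by simp)).integrable_sq

lemma integral_sub_sq_gaussianReal (m : ℝ) (v : ℝ≥0) :
    ∫ x, (x - m) ^ 2 ∂(gaussianReal m v) = v := by
  have h := variance_fun_id_gaussianReal (μ := m) (v := v)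
  rwa [variance_eq_integral aemeasurable_id', integral_id_gaussianReal] at h

lemma integral_sq_gaussianReal (v : ℝ≥0) : ∫ x, x ^ 2 ∂(gaussianReal 0 v) = v := by
  simpa using integral_sub_sq_gaussianReal 0 v

lemma lintegral_gaussianReal {m : ℝ} {v : ℝ≥0} (hv : v ≠ 0) {f : ℝ → ℝ≥0∞} (hf : Measurable f) :
    ∫⁻ x, f x ∂(gaussianReal m v) = ∫⁻ x, ENNReal.ofReal (gaussianPDFReal m v x) * f x := by
  rw [gaussianReal_of_var_ne_zero _ hv,
    lintegral_withDensity_eq_lintegral_mul _ (measurable_gaussianPDF _ _) hf]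
  rfl

/-- Moving `y` to the mean of the Gaussian density, dominated convergence applies: for `|y - y₀| ≤
1` the density with mean `y` is at most a constant times the one with mean `y₀` and doubled
variance, since `(s - y₀)² ≤ 2(s - y)² + 2`. -/
lemma continuous_integral_gaussianReal_add {w : ℝ≥0} (hw : w ≠ 0) {h : ℝ → ℝ} (hm : Measurable h)
    {c : ℝ} (hb : ∀ s, |h s| ≤ c * (1 + s ^ 2)) :
    Continuous fun y => ∫ n, h (y + n) ∂(gaussianReal 0 w) := by
  have hw' : (0 : ℝ) < w := by positivity
  have hform : (fun y => ∫ n, h (y + n) ∂(gaussianReal 0 w))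
      = fun y => ∫ s, gaussianPDFReal y w s * h s := by
    ext y
    rw [← integral_map (φ := fun n => y + n) (f := h) (by fun_prop) hm.aestronglyMeasurable,
      gaussianReal_map_const_add, zero_add, integral_gaussianReal_eq_integral_smul hw]
    rfl
  rw [hform, continuous_iff_continuousAt]
  intro y₀
  set K : ℝ := Real.sqrt (2 * Real.pi * (2 * w)) * (Real.sqrt (2 * Real.pi * w))⁻¹
    * Real.exp (1 / (2 * w)) with hK
  have hdom : ∀ y, |y - y₀| ≤ 1 → ∀ s,
      gaussianPDFReal y w s ≤ K * gaussianPDFReal y₀ (2 * w) s := by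
    intro y hy s
    have h1 : -(s - y) ^ 2 / (2 * w) ≤ 1 / (2 * w) + -(s - y₀) ^ 2 / (2 * (2 * w)) := by
      have h2 : (y - y₀) ^ 2 ≤ 1 := by
        rw [← sq_abs]; nlinarith [abs_nonneg (y - y₀)]
      rw [← sub_nonneg]
      have : 1 / (2 * (w : ℝ)) + -(s - y₀) ^ 2 / (2 * (2 * w)) - -(s - y) ^ 2 / (2 * w)
          = (2 + 2 * (s - y) ^ 2 - (s - y₀) ^ 2) / (4 * w) := by
        field_simp; ring
      rw [this]
      refine div_nonneg ?_ (by positivity)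
      nlinarith [sq_nonneg (s - y - (y - y₀))]
    have h3 := Real.exp_le_exp.2 h1
    rw [Real.exp_add] at h3
    simp only [gaussianPDFReal_def, NNReal.coe_mul, NNReal.coe_ofNat]
    have hs : Real.sqrt (2 * Real.pi * (2 * w)) ≠ 0 := by positivity
    calc (Real.sqrt (2 * Real.pi * w))⁻¹ * Real.exp (-(s - y) ^ 2 / (2 * w))
        ≤ (Real.sqrt (2 * Real.pi * w))⁻¹ * (Real.exp (1 / (2 * w))
          * Real.exp (-(s - y₀) ^ 2 / (2 * (2 * w)))) := by gcongr
      _ = _ := by rw [hK]; field_simp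
  have h2w : 2 * w ≠ 0 := by simpa using hw
  refine continuousAt_of_dominated
    (bound := fun s => K * c * (gaussianPDFReal y₀ (2 * w) s * (1 + s ^ 2))) ?_ ?_ ?_ ?_
  · exact Eventually.of_forall fun y =>
      ((measurable_gaussianPDFReal y w).mul hm).aestronglyMeasurable
  · filter_upwards [Metric.closedBall_mem_nhds y₀ one_pos] with y hy
    refine ae_of_all _ fun s => ?_
    have hy' : |y - y₀| ≤ 1 := by simpa [Real.dist_eq] using hy
    rw [Real.norm_eq_abs, abs_mul, abs_of_nonneg (gaussianPDFReal_nonneg _ _ _)]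
    calc gaussianPDFReal y w s * |h s|
        ≤ (K * gaussianPDFReal y₀ (2 * w) s) * (c * (1 + s ^ 2)) :=
          mul_le_mul (hdom y hy' s) (hb s) (abs_nonneg _)
            (mul_nonneg (by positivity) (gaussianPDFReal_nonneg _ _ _))
      _ = _ := by ring
  · refine Integrable.const_mul ?_ _
    exact (integrable_gaussianReal_iff h2w).1
      ((integrable_const 1).add (integrable_sq_gaussianReal _ _))
  · refine ae_of_all _ fun s => ?_
    simp only [gaussianPDFReal_def]
    fun_prop

/-- Jensen's inequality for `exp`, stated in `[0, ∞]` so that `exp ∘ f` need not be integrable. -/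
lemma ofReal_exp_integral_le {α : Type*} [MeasurableSpace α] {μ : Measure α}
    [IsProbabilityMeasure μ] {f : α → ℝ} (hf : Integrable f μ) :
    ENNReal.ofReal (Real.exp (∫ x, f x ∂μ)) ≤ ∫⁻ x, ENNReal.ofReal (Real.exp (f x)) ∂μ := by
  by_cases htop : ∫⁻ x, ENNReal.ofReal (Real.exp (f x)) ∂μ = ∞
  · rw [htop]; exact le_top
  have hmeas : AEStronglyMeasurable (fun x => Real.exp (f x)) μ :=
    Real.continuous_exp.comp_aestronglyMeasurable hf.1
  have hint : Integrable (fun x => Real.exp (f x)) μ := by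
    refine ⟨hmeas, ?_⟩
    rw [hasFiniteIntegral_iff_ofReal (ae_of_all _ fun x => (Real.exp_pos _).le)]
    exact lt_top_iff_ne_top.2 htop
  rw [← ofReal_integral_eq_lintegral_ofReal hint (ae_of_all _ fun x => (Real.exp_pos _).le)]
  exact ENNReal.ofReal_le_ofReal (convexOn_exp.map_integral_le Real.continuous_exp.continuousOn
    isClosed_univ (ae_of_all _ fun _ => mem_univ _) hf hint)

end GaussianIntegrals

/-! ### The dual entropy power inequality. -/

section DualInequality

open Set Filter Topology
open scoped NNReal

/-- Jensen's inequality on one fibre of the transport argument. -/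
lemma exp_le_lintegral_fibre {w : ℝ≥0} (hw : w ≠ 0) {l : ℝ} (hl0 : 0 < l) (hl1 : l < 1)
    {p : ℝ → ℝ} (hpm : Measurable p) (hp : ∀ s, 0 < p s) {y : ℝ}
    (hint : Integrable (fun n => Real.log (p (y + n))) (gaussianReal 0 w))
    (v : ℝ) {r : ℝ} (hr : 0 < r) :
    ENNReal.ofReal (Real.exp (∫ n, Real.log (p (y + n)) ∂(gaussianReal 0 w)
        + (1 - l) * (Real.log r - 1 / 2 * Real.log (1 - l))
        - 1 / 2 * l * (Real.log l + Real.log w) + 1 / 2 * Real.log w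
        + 1 / 2 * (1 - l) * (1 - v ^ 2)))
      ≤ ∫⁻ n, ENNReal.ofReal (p (y + n)
          * gaussianPDFReal 0 1 (-(√(1 - l) * v) + √l / √w * n)
          * (√(1 - l) * r + √l / √w)) := by
  have hw' : (0 : ℝ) < w := by positivity
  have h1l : 0 < 1 - l := by linarith
  set c := √(1 - l) with hc
  set d := √l with hd
  set β := √(w : ℝ) with hβ
  have hcpos : 0 < c := Real.sqrt_pos.2 h1l
  have hdpos : 0 < d := Real.sqrt_pos.2 hl0
  have hβpos : 0 < β := Real.sqrt_pos.2 hw'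
  have hc2 : c ^ 2 = 1 - l := Real.sq_sqrt h1l.le
  have hd2 : d ^ 2 = l := Real.sq_sqrt hl0.le
  have hβ2 : β ^ 2 = w := Real.sq_sqrt hw'.le
  have hlogc : Real.log c = 1 / 2 * Real.log (1 - l) := by
    rw [hc, Real.log_sqrt h1l.le]; ring
  have hlogd : Real.log d = 1 / 2 * Real.log l := by
    rw [hd, Real.log_sqrt hl0.le]; ring
  have hlogβ : Real.log β = 1 / 2 * Real.log w := by
    rw [hβ, Real.log_sqrt hw'.le]; ring
  set J := c * r + d / β with hJ
  have hJpos : 0 < J := by positivity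
  -- Concavity of `log`: `J` is the mean of `r / √(1 - l)` and `1 / √(l w)` with weights `1 - l` and
  -- `l`.
  have hlogJ : (1 - l) * (Real.log r - 1 / 2 * Real.log (1 - l))
      - 1 / 2 * l * (Real.log l + Real.log w) ≤ Real.log J := by
    have h := strictConcaveOn_log_Ioi.concaveOn.2 (x := r / c) (y := 1 / (d * β))
      (mem_Ioi.2 (by positivity)) (mem_Ioi.2 (by positivity)) h1l.le hl0.le (by ring)
    simp only [smul_eq_mul] at h
    have e1 : (1 - l) * (r / c) + l * (1 / (d * β)) = J := by
      rw [hJ, ← hc2, ← hd2]; field_simp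
    rw [e1, Real.log_div hr.ne' hcpos.ne', one_div, Real.log_inv,
      Real.log_mul hdpos.ne' hβpos.ne', hlogc, hlogd, hlogβ] at h
    linarith
  set α₀ := -(c * v) ^ 2 / 2 + Real.log J + 1 / 2 * Real.log w with hα₀
  set α₁ := c * v * (d / β) with hα₁
  set α₂ := (1 - l) / (2 * w) with hα₂
  -- `L` is the logarithm of the integrand divided by the density of the noise, so Jensen's
  -- inequality applies under the law of the noise; the Gaussian factors contribute only a quadratic
  -- polynomial in `n`.
  set L : ℝ → ℝ := fun n => Real.log (p (y + n)) + (α₀ + α₁ * n + α₂ * n ^ 2) with hL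
  have hq : Integrable (fun n => α₀ + α₁ * n + α₂ * n ^ 2) (gaussianReal 0 w) :=
    ((integrable_const α₀).add ((integrable_id_gaussianReal 0 w).const_mul α₁)).add
      ((integrable_sq_gaussianReal 0 w).const_mul α₂)
  have hLint : Integrable L (gaussianReal 0 w) := hint.add hq
  have hLval : ∫ n, L n ∂(gaussianReal 0 w)
      = ∫ n, Real.log (p (y + n)) ∂(gaussianReal 0 w) + (α₀ + (1 - l) / 2) := by
    rw [hL, integral_add hint hq, integral_add, integral_add, integral_const_mul,
      integral_const_mul, integral_id_gaussianReal, integral_sq_gaussianReal]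
    · simp [hα₂]; field_simp
    · exact integrable_const _
    · exact (integrable_id_gaussianReal 0 w).const_mul α₁
    · exact (integrable_const α₀).add ((integrable_id_gaussianReal 0 w).const_mul α₁)
    · exact (integrable_sq_gaussianReal 0 w).const_mul α₂
  have hpt : ∀ n, gaussianPDFReal 0 w n * Real.exp (L n)
      = p (y + n) * gaussianPDFReal 0 1 (-(c * v) + d / β * n) * J := by
    intro n
    have hg := gaussianPDFReal_pos 0 w n hw
    have hg1 := gaussianPDFReal_pos 0 1 (-(c * v) + d / β * n) one_ne_zero
    have h0 := hp (y + n)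
    rw [← Real.exp_log (mul_pos (mul_pos h0 hg1) hJpos), ← Real.exp_log hg, ← Real.exp_add,
      Real.log_mul (mul_pos h0 hg1).ne' hJpos.ne', Real.log_mul h0.ne' hg1.ne',
      log_gaussianPDFReal _ hw, log_gaussianPDFReal _ one_ne_zero, hL, hα₀, hα₁, hα₂,
      Real.log_mul (by positivity) hw'.ne']
    congr 1
    simp only [NNReal.coe_one, mul_one]
    rw [← hd2, ← hβ2]
    field_simp
    ring
  calc _ ≤ ENNReal.ofReal (Real.exp (∫ n, L n ∂(gaussianReal 0 w))) := by
        refine ENNReal.ofReal_le_ofReal (Real.exp_le_exp.2 ?_)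
        rw [hLval, hα₀, mul_pow, hc2]
        linarith
    _ ≤ ∫⁻ n, ENNReal.ofReal (Real.exp (L n)) ∂(gaussianReal 0 w) := ofReal_exp_integral_le hLint
    _ = _ := by
        rw [lintegral_gaussianReal hw (by fun_prop)]
        refine lintegral_congr fun n => ?_
        rw [← ENNReal.ofReal_mul (gaussianPDFReal_nonneg _ _ _), hpt]

/-- The change of variables `(y, n) ↦ (y + n, -c V(y) + e n)` does not increase the mass. -/
lemma lintegral_fibre_le {A B : ℝ} {p : ℝ → ℝ} (hpm : Measurable p) (hp0 : ∀ s, 0 ≤ p s)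
    {V r : ℝ → ℝ} (hVm : Measurable V) (hrm : Measurable r) (hr : ∀ y, 0 < r y)
    (hV : ∀ y ∈ Ioo A B, HasDerivAt V (r y) y) {c e : ℝ} (hc : 0 < c) (he : 0 < e) :
    ∫⁻ y in Ioo A B, ∫⁻ n, ENNReal.ofReal (p (y + n)
        * gaussianPDFReal 0 1 (-(c * V y) + e * n) * (c * r y + e))
      ≤ ∫⁻ s, ENNReal.ofReal (p s) := by
  have hgm : Measurable (gaussianPDFReal 0 1) := measurable_gaussianPDFReal 0 1
  have hshift : ∀ y, ∫⁻ n, ENNReal.ofReal (p (y + n)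
        * gaussianPDFReal 0 1 (-(c * V y) + e * n) * (c * r y + e))
      = ∫⁻ s, ENNReal.ofReal (p s)
        * (ENNReal.ofReal |-(c * r y + e)|
          * ENNReal.ofReal (gaussianPDFReal 0 1 (-(c * V y) + e * (s - y)))) := by
    intro y
    symm
    rw [← lintegral_add_right_eq_self _ y]
    refine lintegral_congr fun n => ?_
    have hpos : 0 < c * r y + e := by have := hr y; positivity
    rw [abs_neg, abs_of_pos hpos, ← ENNReal.ofReal_mul hpos.le, ← ENNReal.ofReal_mul (hp0 _)]
    rw [add_sub_cancel_right, add_comm n y]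
    congr 1
    ring
  simp_rw [hshift]
  rw [lintegral_lintegral_swap (by fun_prop)]
  refine lintegral_mono fun s => ?_
  rw [lintegral_const_mul _ (by fun_prop)]
  refine mul_le_of_le_one_right (by positivity) ?_
  -- For fixed `s = y + n`, the Jacobian `c r + e` is the absolute derivative of the strictly
  -- decreasing map `y ↦ -c V(y) + e (s - y)`. The inner integral is therefore the Gaussian mass of
  -- an image, at most `1`.
  have hder : ∀ y ∈ Ioo A B, HasDerivWithinAt (fun y => -(c * V y) + e * (s - y))
      (-(c * r y + e)) (Ioo A B) y := by
    intro y hy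
    have h := (((hV y hy).const_mul c).neg).add (((hasDerivAt_id y).const_sub s).const_mul e)
    have h' : HasDerivAt (fun y => -(c * V y) + e * (s - y)) (-(c * r y + e)) y := by
      exact h.congr_deriv (by ring)
    exact h'.hasDerivWithinAt
  have hinj : InjOn (fun y => -(c * V y) + e * (s - y)) (Ioo A B) := by
    refine StrictAntiOn.injOn ?_
    refine strictAntiOn_of_deriv_neg (convex_Ioo A B)
      (fun y hy => (hder y hy).continuousWithinAt) fun y hy => ?_
    rw [interior_Ioo] at hy
    rw [((hder y hy).hasDerivAt (isOpen_Ioo.mem_nhds hy)).deriv]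
    have := hr y
    have : 0 < c * r y + e := by positivity
    linarith
  rw [← lintegral_image_eq_lintegral_abs_deriv_mul measurableSet_Ioo hder hinj
    (fun x => ENNReal.ofReal (gaussianPDFReal 0 1 x))]
  exact (setLIntegral_le_lintegral _ _).trans (lintegral_gaussianPDFReal_eq_one 0 one_ne_zero).le

/-- Dual form of the entropy power inequality with one Gaussian summand. -/
theorem lintegral_exp_integral_log_le {w : ℝ≥0} (hw : w ≠ 0) {l : ℝ} (hl0 : 0 < l) (hl1 : l < 1)
    {p : ℝ → ℝ} (hpm : Measurable p) (hp : ∀ s, 0 < p s) {c : ℝ}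
    (hb : ∀ s, |Real.log (p s)| ≤ c * (1 + s ^ 2)) (hp1 : ∫⁻ s, ENNReal.ofReal (p s) ≤ 1) :
    ∫⁻ y, ENNReal.ofReal (Real.exp ((∫ n, Real.log (p (y + n)) ∂(gaussianReal 0 w)) / l))
      ≤ ENNReal.ofReal (Real.exp ((1 / 2 * l * Real.log l + 1 / 2 * (1 - l) * Real.log (1 - l)
        - 1 / 2 * (1 - l) * (Real.log (2 * Real.pi * w) + 1)) / l)) := by
  have hw' : (0 : ℝ) < w := by positivity
  set K := 1 / 2 * l * Real.log l + 1 / 2 * (1 - l) * Real.log (1 - l)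
        - 1 / 2 * (1 - l) * (Real.log (2 * Real.pi * w) + 1) with hK
  set G : ℝ → ℝ := fun y => ∫ n, Real.log (p (y + n)) ∂(gaussianReal 0 w) with hG
  have hlogm : Measurable fun s => Real.log (p s) := by fun_prop
  have hGc : Continuous G := continuous_integral_gaussianReal_add hw hlogm hb
  have hint : ∀ y, Integrable (fun n => Real.log (p (y + n))) (gaussianReal 0 w) := by
    intro y
    refine Integrable.mono' (g := fun n => c * (1 + 2 * y ^ 2) + 2 * c * n ^ 2)
      ((integrable_const _).add ((integrable_sq_gaussianReal 0 w).const_mul _))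
      (hlogm.comp (measurable_const_add y)).aestronglyMeasurable (ae_of_all _ fun n => ?_)
    have hc0 : 0 ≤ c := by simpa using (abs_nonneg _).trans (hb 0)
    rw [Real.norm_eq_abs]
    refine (hb _).trans ?_
    nlinarith [mul_nonneg hc0 (sq_nonneg (y - n))]
  set q : ℝ → ℝ := fun y => Real.exp (G y / l) with hq
  have hqc : Continuous q := by fun_prop
  have hqpos : ∀ y, 0 < q y := fun y => Real.exp_pos _
  -- Integrability of `q` on the line is not yet known, so the transport is done on bounded
  -- intervals, with a bound that does not depend on them.
  have key : ∀ A B : ℝ, A < B → ∫⁻ y in Ioo A B, ENNReal.ofReal (q y)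
      ≤ ENNReal.ofReal (Real.exp (K / l)) := by
    intro A B hAB
    obtain ⟨V, hVm, hV⟩ := exists_gaussian_transport hqc hqpos hAB
    set Z := ∫ t in A..B, q t with hZ
    have hZpos : 0 < Z :=
      intervalIntegral.intervalIntegral_pos_of_pos (hqc.intervalIntegrable _ _) hqpos hAB
    have hZl : ∫⁻ y in Ioo A B, ENNReal.ofReal (q y) = ENNReal.ofReal Z := by
      rw [hZ, intervalIntegral.integral_of_le hAB.le, integral_Ioc_eq_integral_Ioo,
        ofReal_integral_eq_lintegral_ofReal _ (ae_of_all _ fun y => (hqpos y).le)]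
      exact (hqc.integrableOn_Icc (a := A) (b := B)).mono_set Ioo_subset_Icc_self
    set r : ℝ → ℝ := fun y => q y / (Z * gaussianPDFReal 0 1 (V y)) with hr
    have hrpos : ∀ y, 0 < r y := fun y =>
      div_pos (hqpos y) (mul_pos hZpos (gaussianPDFReal_pos 0 1 _ one_ne_zero))
    have hgm : Measurable (gaussianPDFReal 0 1) := measurable_gaussianPDFReal 0 1
    have hrm : Measurable r := by fun_prop
    have hpt : ∀ y, ENNReal.ofReal (q y) * ENNReal.ofReal (Real.exp (-(1 - l) * Real.log Z - K))
        ≤ ∫⁻ n, ENNReal.ofReal (p (y + n)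
          * gaussianPDFReal 0 1 (-(√(1 - l) * V y) + √l / √w * n)
          * (√(1 - l) * r y + √l / √w)) := by
      intro y
      refine le_trans (le_of_eq ?_)
        (exp_le_lintegral_fibre hw hl0 hl1 hpm hp (hint y) (V y) (hrpos y))
      rw [← ENNReal.ofReal_mul (hqpos y).le, hq, ← Real.exp_add]
      congr 2
      -- The term `V² / 2` cancels the `V²` in the fibre estimate, leaving a bound free of the
      -- transport map.
      have hlogr : Real.log (r y) = G y / l - Real.log Z
          + 1 / 2 * Real.log (2 * Real.pi) + (V y) ^ 2 / 2 := by
        have hg := gaussianPDFReal_pos 0 1 (V y) one_ne_zero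
        rw [hr, Real.log_div (hqpos y).ne' (mul_pos hZpos hg).ne', Real.log_mul hZpos.ne' hg.ne',
          log_gaussianPDFReal _ one_ne_zero, hq, Real.log_exp]
        simp
        ring
      rw [hlogr, hK, Real.log_mul (by positivity) hw'.ne']
      change _ = G y + _ - _ + _ + _
      field_simp
      ring
    -- This says `Z ^ l ≤ e ^ K`.
    have h1 : ENNReal.ofReal Z * ENNReal.ofReal (Real.exp (-(1 - l) * Real.log Z - K)) ≤ 1 := by
      rw [← hZl, ← lintegral_mul_const _ (by fun_prop)]
      refine (lintegral_mono fun y => hpt y).trans ?_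
      exact (lintegral_fibre_le hpm (fun s => (hp s).le) hVm hrm hrpos hV
        (Real.sqrt_pos.2 (by linarith))
        (div_pos (Real.sqrt_pos.2 hl0) (Real.sqrt_pos.2 hw'))).trans hp1
    rw [← ENNReal.ofReal_mul hZpos.le, ENNReal.ofReal_le_one] at h1
    have h2 : Real.log Z + (-(1 - l) * Real.log Z - K) ≤ 0 := by
      rw [← Real.exp_le_one_iff, Real.exp_add, Real.exp_log hZpos]
      exact h1
    rw [hZl]
    refine ENNReal.ofReal_le_ofReal ?_
    rw [← Real.log_le_iff_le_exp hZpos, le_div_iff₀ hl0]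
    linarith
  have hcov : AECover volume atTop fun n : ℕ => Ioo (-((n : ℝ) + 1)) ((n : ℝ) + 1) :=
    aecover_Ioo (tendsto_neg_atTop_atBot.comp
        (tendsto_atTop_add_const_right _ _ tendsto_natCast_atTop_atTop))
      (tendsto_atTop_add_const_right _ _ tendsto_natCast_atTop_atTop)
  refine le_of_tendsto (hcov.lintegral_tendsto_of_countably_generated
    (f := fun y => ENNReal.ofReal (q y)) (by fun_prop)) ?_
  exact Eventually.of_forall fun n => key _ _ (by linarith [n.cast_nonneg (α := ℝ)])

end DualInequality

/-! ### Donsker–Varadhan and conditional entropy. -/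

section Entropy

open Set Filter Topology InformationTheory
open scoped NNReal

/-- A one-sided Donsker–Varadhan inequality. -/
theorem integrable_and_integral_le_klDiv {α : Type*} [MeasurableSpace α] {π μ : Measure α}
    [IsProbabilityMeasure π] [IsProbabilityMeasure μ] (hkl : klDiv π μ ≠ ∞)
    {g : α → ℝ} (hg : Measurable g) {c : ℝ}
    (hexp : ∫⁻ x, ENNReal.ofReal (Real.exp (g x)) ∂μ ≤ ENNReal.ofReal (Real.exp c))
    {b : α → ℝ} (hb : Integrable b π) (hbg : ∀ x, b x ≤ g x) :
    Integrable g π ∧ ∫ x, g x ∂π ≤ (klDiv π μ).toReal + c := by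
  obtain ⟨hac, hint⟩ := klDiv_ne_top_iff.1 hkl
  have hllr : Measurable (llr π μ) := measurable_llr π μ
  set L : α → ℝ := fun x => g x - c - llr π μ x with hL
  have hLm : Measurable L := (hg.sub_const c).sub hllr
  -- Where `dπ/dμ` is positive, `(dπ/dμ) e^L = e^{g - c}`; where it vanishes the left side is zero.
  have hle : ∫⁻ x, ENNReal.ofReal (Real.exp (L x)) ∂π ≤ 1 := by
    rw [← lintegral_rnDeriv_mul hac (by fun_prop)]
    calc ∫⁻ x, π.rnDeriv μ x * ENNReal.ofReal (Real.exp (L x)) ∂μ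
        ≤ ∫⁻ x, ENNReal.ofReal (Real.exp (g x)) * ENNReal.ofReal (Real.exp (-c)) ∂μ := by
          refine lintegral_mono_ae ?_
          filter_upwards [π.rnDeriv_lt_top μ] with x hx
          rcases eq_or_ne (π.rnDeriv μ x) 0 with h0 | h0
          · simp [h0]
          have hpos : 0 < (π.rnDeriv μ x).toReal := ENNReal.toReal_pos h0 hx.ne
          rw [← ENNReal.ofReal_toReal hx.ne, ← ENNReal.ofReal_mul hpos.le,
            ← ENNReal.ofReal_mul (Real.exp_pos _).le, ← Real.exp_add]
          refine ENNReal.ofReal_le_ofReal (le_of_eq ?_)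
          rw [hL]
          simp only [llr]
          rw [Real.exp_sub, Real.exp_log hpos, sub_eq_add_neg]
          field_simp
      _ ≤ ENNReal.ofReal (Real.exp c) * ENNReal.ofReal (Real.exp (-c)) := by
          rw [lintegral_mul_const _ (by fun_prop)]
          gcongr
      _ = 1 := by
          rw [← ENNReal.ofReal_mul (Real.exp_pos _).le, ← Real.exp_add]
          simp
  have heint : Integrable (fun x => Real.exp (L x)) π := by
    refine ⟨by fun_prop, ?_⟩
    rw [hasFiniteIntegral_iff_ofReal (ae_of_all _ fun x => (Real.exp_pos _).le)]
    exact hle.trans_lt ENNReal.one_lt_top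
  have heval : ∫ x, Real.exp (L x) ∂π ≤ 1 := by
    rw [integral_eq_lintegral_of_nonneg_ae (ae_of_all _ fun x => (Real.exp_pos _).le)
      (by fun_prop)]
    exact ENNReal.toReal_le_of_le_ofReal zero_le_one (by simpa using hle)
  have hup : ∀ x, L x ≤ Real.exp (L x) - 1 := fun x => by linarith [Real.add_one_le_exp (L x)]
  -- Above, `L ≤ e^L - 1`; below, the minorant `b` takes over. No prior integrability of `g` is
  -- needed.
  have hLint : Integrable L π := by
    refine integrable_of_le_of_le hLm.aestronglyMeasurable
      (g₁ := fun x => b x - c - llr π μ x) (g₂ := fun x => Real.exp (L x) - 1)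
      (ae_of_all _ fun x => ?_) (ae_of_all _ hup) ((hb.sub (integrable_const c)).sub hint)
      (heint.sub (integrable_const 1))
    have := hbg x
    simp only [hL]
    linarith
  have hgeq : g = fun x => L x + (c + llr π μ x) := by
    ext x; simp only [hL]; ring
  have hgint : Integrable g π := by
    rw [hgeq]; exact hLint.add ((integrable_const c).add hint)
  refine ⟨hgint, ?_⟩
  have h1 : ∫ x, L x ∂π ≤ 0 := by
    calc ∫ x, L x ∂π ≤ ∫ x, (Real.exp (L x) - 1) ∂π :=
          integral_mono hLint (heint.sub (integrable_const 1)) hup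
      _ ≤ 0 := by
          rw [integral_sub heint (integrable_const 1)]
          simpa using heval
  have h2 : ∫ x, L x ∂π = ∫ x, g x ∂π - c - ∫ x, llr π μ x ∂π := by
    have hgc : Integrable (fun x => g x - c) π := hgint.sub (integrable_const c)
    rw [integral_sub hgc hint, integral_sub hgint (integrable_const c)]
    simp
  rw [toReal_klDiv_of_measure_eq hac (by simp)]
  linarith

lemma coe_integral_eq_lintegral_sub {α : Type*} [MeasurableSpace α] {μ : Measure α} {f : α → ℝ}
    (hf : Integrable f μ) :
    ((∫ x, f x ∂μ : ℝ) : EReal) = ((∫⁻ x, ENNReal.ofReal (f x) ∂μ : ℝ≥0∞) : EReal)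
      - ((∫⁻ x, ENNReal.ofReal (-f x) ∂μ : ℝ≥0∞) : EReal) := by
  have h1 : ∫⁻ x, ENNReal.ofReal (f x) ∂μ ≠ ∞ := hf.lintegral_lt_top.ne
  have h2 : ∫⁻ x, ENNReal.ofReal (-f x) ∂μ ≠ ∞ := hf.neg.lintegral_lt_top.ne
  rw [integral_eq_lintegral_pos_part_sub_lintegral_neg_part hf, EReal.coe_sub,
    EReal.coe_ennreal_toReal h1, EReal.coe_ennreal_toReal h2]

/-- The integrable minorant makes the negative part of `-log f(S | Y)` integrable, so the difference
defining the entropy is not of the form `∞ - ∞`. -/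
lemma le_condEntropy {β : Type*} [MeasurableSpace β] {ρ : Measure (β × ℝ)}
    (hac : ρ ≪ ρ.fst.prod volume) {f : β × ℝ → ℝ} (hf : Integrable f ρ)
    (hle : ∀ᵐ q ∂ρ, f q ≤ -Real.log (condDensity ρ q)) :
    ((∫ q, f q ∂ρ : ℝ) : EReal) ≤ condEntropy ρ := by
  rw [condEntropy, if_pos hac, coe_integral_eq_lintegral_sub hf]
  refine EReal.sub_le_sub ?_ ?_
  · rw [EReal.coe_ennreal_le_coe_ennreal_iff]
    refine lintegral_mono_ae ?_
    filter_upwards [hle] with q hq using ENNReal.ofReal_le_ofReal hq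
  · rw [EReal.coe_ennreal_le_coe_ennreal_iff]
    refine lintegral_mono_ae ?_
    filter_upwards [hle] with q hq using ENNReal.ofReal_le_ofReal (by linarith)

lemma condEntropy_eq_integral {β : Type*} [MeasurableSpace β] {ρ : Measure (β × ℝ)}
    (hac : ρ ≪ ρ.fst.prod volume) {f : β × ℝ → ℝ} (hf : Integrable f ρ)
    (heq : ∀ᵐ q ∂ρ, -Real.log (condDensity ρ q) = f q) :
    condEntropy ρ = ((∫ q, f q ∂ρ : ℝ) : EReal) := by
  rw [condEntropy, if_pos hac, coe_integral_eq_lintegral_sub hf]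
  congr 2
  · refine lintegral_congr_ae ?_
    filter_upwards [heq] with q hq using by rw [hq]
  · refine lintegral_congr_ae ?_
    filter_upwards [heq] with q hq using by rw [← hq, neg_neg]

/-- The law of `(U, g U + N)` with `U ∼ μ` and an independent centred Gaussian noise `N` of
variance `v`. -/
noncomputable def noisyGraph {β : Type*} [MeasurableSpace β] (μ : Measure β) (g : β → ℝ) (v : ℝ≥0) :
    Measure (β × ℝ) :=
  (μ.prod (gaussianReal 0 v)).map (fun q => (q.1, g q.1 + q.2))

section NoisyGraph

variable {β : Type*} [MeasurableSpace β] {μ : Measure β} {g : β → ℝ}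
  {v : ℝ≥0}

lemma fst_noisyGraph (hg : Measurable g) : (noisyGraph μ g v).fst = μ := by
  rw [noisyGraph, Measure.fst_map_prodMk (by fun_prop)]
  exact Measure.fst_prod

lemma lintegral_noisyGraph (hg : Measurable g) {f : β × ℝ → ℝ≥0∞} (hf : Measurable f) :
    ∫⁻ q, f q ∂(noisyGraph μ g v) = ∫⁻ u, ∫⁻ s, f (u, s) ∂(gaussianReal (g u) v) ∂μ := by
  rw [noisyGraph, lintegral_map hf (by fun_prop), lintegral_prod _ (by fun_prop)]
  refine lintegral_congr fun u => ?_
  rw [← lintegral_map (f := fun s => f (u, s)) (g := fun n => g u + n) (by fun_prop)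
    (by fun_prop), gaussianReal_map_const_add, zero_add]

lemma measurable_gaussianPDF_comp (hg : Measurable g) :
    Measurable fun q : β × ℝ => gaussianPDF (g q.1) v q.2 :=
  measurable_uncurry_gaussianPDF.comp
    (((hg.comp measurable_fst).prodMk (measurable_const.prodMk measurable_snd)))

lemma noisyGraph_eq_withDensity (hg : Measurable g) (hv : v ≠ 0) :
    noisyGraph μ g v = (μ.prod volume).withDensity fun q => gaussianPDF (g q.1) v q.2 := by
  refine Measure.ext_of_lintegral _ fun f hf => ?_
  have hm := measurable_gaussianPDF_comp (v := v) hg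
  rw [lintegral_noisyGraph hg hf, lintegral_withDensity_eq_lintegral_mul _ hm hf,
    lintegral_prod _ (hm.mul hf).aemeasurable]
  refine lintegral_congr fun u => ?_
  rw [lintegral_gaussianReal hv (by fun_prop)]
  rfl

/-- Given `U = u` the law is Gaussian with mean `g u`, and Gaussian entropy does not depend on the
mean. -/
lemma condEntropy_noisyGraph [IsProbabilityMeasure μ] (hg : Measurable g) (hv : v ≠ 0) :
    condEntropy (noisyGraph μ g v)
      = ((1 / 2 * (Real.log (2 * Real.pi * v) + 1) : ℝ) : EReal) := by
  have hv' : (0 : ℝ) < v := by positivity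
  have hm := measurable_gaussianPDF_comp (v := v) hg
  have hac : noisyGraph μ g v ≪ μ.prod volume := by
    rw [noisyGraph_eq_withDensity hg hv]
    exact withDensity_absolutelyContinuous _ _
  have hmap : Measurable fun q : β × ℝ => (q.1, g q.1 + q.2) := by fun_prop
  have hval : Integrable (fun q : β × ℝ => 1 / 2 * Real.log (2 * Real.pi * v)
        + (q.2 - g q.1) ^ 2 / (2 * v)) (noisyGraph μ g v)
      ∧ ∫ q, (1 / 2 * Real.log (2 * Real.pi * v) + (q.2 - g q.1) ^ 2 / (2 * v))
        ∂(noisyGraph μ g v) = 1 / 2 * (Real.log (2 * Real.pi * v) + 1) := by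
    have hfm : Measurable fun q : β × ℝ => 1 / 2 * Real.log (2 * Real.pi * v)
        + (q.2 - g q.1) ^ 2 / (2 * v) := by fun_prop
    have hi : Integrable (fun q : β × ℝ => q.2 ^ 2) (μ.prod (gaussianReal 0 v)) :=
      (integrable_sq_gaussianReal 0 v).comp_snd μ
    constructor
    · rw [noisyGraph, integrable_map_measure hfm.aestronglyMeasurable hmap.aemeasurable]
      simp only [Function.comp_def, add_sub_cancel_left]
      exact (integrable_const _).add (hi.div_const _)
    · rw [noisyGraph, integral_map hmap.aemeasurable hfm.aestronglyMeasurable]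
      simp only [add_sub_cancel_left]
      rw [integral_add (integrable_const _) (hi.div_const _), integral_div,
        integral_fun_snd (f := fun n : ℝ => n ^ 2), integral_sq_gaussianReal]
      simp
      field_simp
  rw [condEntropy_eq_integral (by rwa [fst_noisyGraph hg]) hval.1, hval.2]
  refine hac.ae_le ?_
  have h := Measure.rnDeriv_withDensity (μ.prod (volume : Measure ℝ)) hm
  rw [← noisyGraph_eq_withDensity hg hv] at h
  filter_upwards [h] with q hq
  rw [condDensity, fst_noisyGraph hg, hq, toReal_gaussianPDF, log_gaussianPDFReal _ hv]
  ring

end NoisyGraph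

end Entropy

/-! ### The joint law of a representation and the class variable. -/

section RepLaw

open Set Filter Topology InformationTheory
open scoped NNReal

lemma lintegral_comp_affine {a : ℝ} (ha : a ≠ 0) (b : ℝ) {h : ℝ → ℝ≥0∞} (hh : Measurable h) :
    ∫⁻ x, h (a * x + b) = ENNReal.ofReal |a⁻¹| * ∫⁻ y, h y := by
  have h1 : ∫⁻ x, h (a * x + b) = ∫⁻ y, h (y + b) ∂(Measure.map (a * ·) volume) :=
    (lintegral_map (f := fun y => h (y + b)) (by fun_prop) (by fun_prop)).symm
  rw [h1, Real.map_volume_mul_left ha, lintegral_smul_measure, lintegral_add_right_eq_self]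
  rfl

/-- A singular part can only lose mass, so the fibre mass is at most `1` without absolute
continuity; the inequality is tested on cylinders `A × ℝ`. -/
lemma lintegral_rnDeriv_fst_prod_le {β : Type*} [MeasurableSpace β] {ρ : Measure (β × ℝ)}
    [IsFiniteMeasure ρ] :
    ∀ᵐ u ∂ρ.fst, ∫⁻ s, ρ.rnDeriv (ρ.fst.prod volume) (u, s) ≤ 1 := by
  have hm : Measurable (ρ.rnDeriv (ρ.fst.prod volume)) := Measure.measurable_rnDeriv _ _
  refine ae_le_of_forall_setLIntegral_le_of_sigmaFinite (g := fun _ => 1)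
    hm.lintegral_prod_right' fun A hA _ => ?_
  have hres : (ρ.fst.restrict A).prod volume
      = (ρ.fst.prod (volume : Measure ℝ)).restrict (A ×ˢ univ) := by
    rw [← Measure.prod_restrict, Measure.restrict_univ]
  rw [setLIntegral_one, ← lintegral_prod (μ := ρ.fst.restrict A) _ hm.aemeasurable, hres]
  refine (Measure.setLIntegral_rnDeriv_le _).trans (le_of_eq ?_)
  rw [Measure.fst_apply hA]
  congr 1
  ext q
  simp

/-- The law of `(U, a X + b + N)` when `(X, U) ∼ π` and `N` is an independent centred Gaussian
noise of variance `w`. -/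
noncomputable def repLaw {β : Type*} [MeasurableSpace β] (π : Measure (ℝ × β)) (a b : ℝ)
    (w : ℝ≥0) : Measure (β × ℝ) :=
  (π.prod (gaussianReal 0 w)).map (fun q => (q.1.2, a * q.1.1 + b + q.2))

variable {β : Type*} [MeasurableSpace β] {π : Measure (ℝ × β)} {a b : ℝ} {w : ℝ≥0}

lemma fst_repLaw : (repLaw π a b w).fst = π.snd := by
  rw [repLaw, Measure.fst_map_prodMk (by fun_prop), ← Function.comp_def Prod.snd Prod.fst,
    ← Measure.map_map measurable_snd measurable_fst]
  change (π.prod _).fst.snd = _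
  rw [Measure.fst_prod]

lemma lintegral_repLaw {f : β × ℝ → ℝ≥0∞} (hf : Measurable f) :
    ∫⁻ q, f q ∂(repLaw π a b w)
      = ∫⁻ q, ∫⁻ s, f (q.2, s) ∂(gaussianReal (a * q.1 + b) w) ∂π := by
  rw [repLaw, lintegral_map hf (by fun_prop), lintegral_prod _ (by fun_prop)]
  refine lintegral_congr fun q => ?_
  rw [← lintegral_map (f := fun s => f (q.2, s)) (g := fun n => a * q.1 + b + n) (by fun_prop)
    (by fun_prop), gaussianReal_map_const_add, zero_add]

lemma lawSourceRep_noisyGraph {μ : Measure ℝ} {g : ℝ → ℝ} (hg : Measurable g)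
    (κ : Kernel ℝ β) : lawSourceRep (noisyGraph μ g w) κ = μ ⊗ₘ κ := by
  rw [lawSourceRep, fst_noisyGraph hg]

/-- The Markov chain read in two orders: the noise that produces `S` from `X` is independent of the
pair `(X, Z)`, so `S` may be generated before or after `Z`. -/
lemma lawRepClass_noisyGraph {μ : Measure ℝ} [SFinite μ] (κ : Kernel ℝ β) [IsMarkovKernel κ] :
    lawRepClass (noisyGraph μ (fun x => a * x + b) w) κ = repLaw (μ ⊗ₘ κ) a b w := by
  have hg : Measurable fun x : ℝ => a * x + b := by fun_prop
  have : SFinite (noisyGraph μ (fun x => a * x + b) w) := by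
    rw [noisyGraph]; infer_instance
  refine Measure.ext_of_lintegral _ fun f hf => ?_
  rw [lawRepClass, lintegral_map hf (by fun_prop), Measure.lintegral_compProd (by fun_prop),
    lintegral_repLaw hf, Measure.lintegral_compProd]
  · simp only [Kernel.comap_apply]
    rw [lintegral_noisyGraph hg]
    · refine lintegral_congr fun x => ?_
      rw [lintegral_lintegral_swap]
      exact hf.aemeasurable
    · have : Measurable fun q : (ℝ × ℝ) × β => f (q.2, q.1.2) := by fun_prop
      exact (this.lintegral_kernel_prod_right (κ := κ.comap Prod.fst measurable_fst))
  · have h1 : Measurable fun q : (ℝ × β) × ℝ => f (q.1.2, a * q.1.1 + b + q.2) := by fun_prop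
    have h2 : (fun q : ℝ × β => ∫⁻ s, f (q.2, s) ∂(gaussianReal (a * q.1 + b) w))
        = fun q : ℝ × β => ∫⁻ n, f (q.2, a * q.1 + b + n) ∂(gaussianReal 0 w) := by
      ext q
      rw [← lintegral_map (f := fun s => f (q.2, s)) (g := fun n => a * q.1 + b + n)
        (by fun_prop) (by fun_prop), gaussianReal_map_const_add, zero_add]
    rw [h2]
    exact h1.lintegral_prod_right'

/-- The density of the noise is at most its peak value `(2πw)^{-1/2}`; this bounds the conditional
density of `S`. -/
lemma repLaw_le (hw : w ≠ 0) [SFinite π] :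
    repLaw π a b w ≤ ENNReal.ofReal (√(2 * Real.pi * w))⁻¹ • (π.snd.prod volume) := by
  refine Measure.le_iff.2 fun s hs => ?_
  rw [← lintegral_indicator_one hs, lintegral_repLaw (measurable_one.indicator hs),
    Measure.smul_apply, smul_eq_mul, Measure.prod_apply hs]
  have hm : Measurable fun u : β => volume (Prod.mk u ⁻¹' s : Set ℝ) :=
    measurable_measure_prodMk_left hs
  have hm' : Measurable fun q : ℝ × β => volume (Prod.mk q.2 ⁻¹' s : Set ℝ) :=
    hm.comp measurable_snd
  rw [Measure.snd, lintegral_map hm measurable_snd, ← lintegral_const_mul _ hm']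
  refine lintegral_mono fun q => ?_
  have hind : Measurable fun t : ℝ => s.indicator (1 : β × ℝ → ℝ≥0∞) (q.2, t) :=
    (measurable_one.indicator hs).comp measurable_prodMk_left
  have hs' : MeasurableSet (Prod.mk q.2 ⁻¹' s : Set ℝ) := measurable_prodMk_left hs
  rw [lintegral_gaussianReal hw hind, ← lintegral_indicator_one hs',
    ← lintegral_const_mul _ (measurable_one.indicator hs')]
  refine lintegral_mono fun t => ?_
  refine mul_le_mul' (ENNReal.ofReal_le_ofReal ?_) le_rfl
  rw [gaussianPDFReal_def]
  refine mul_le_of_le_one_right (by positivity) (Real.exp_le_one_iff.2 ?_)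
  rw [neg_div]
  exact neg_nonpos.2 (by positivity)

/-- With noise, the bounded density suffices. Without noise, `S` is an invertible affine image of
`X`, and `hac`, a consequence of finite mutual information, gives `X` a conditional density. -/
lemma repLaw_absolutelyContinuous [IsFiniteMeasure π] {m : ℝ} {v : ℝ≥0} (hv : v ≠ 0)
    (hac : π ≪ (gaussianReal m v).prod π.snd) (haw : a ≠ 0 ∨ w ≠ 0) :
    repLaw π a b w ≪ π.snd.prod volume := by
  by_cases hw : w = 0
  · have ha : a ≠ 0 := haw.resolve_right (by simpa using hw)
    have h1 : repLaw π a b w = π.map (fun q => (q.2, a * q.1 + b)) := by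
      refine Measure.ext_of_lintegral _ fun f hf => ?_
      rw [lintegral_repLaw hf, lintegral_map hf (by fun_prop), hw]
      refine lintegral_congr fun q => ?_
      rw [gaussianReal_zero_var, lintegral_dirac' _ (by fun_prop)]
    have h2 : ((volume : Measure ℝ).prod π.snd).map (fun q => (q.2, a * q.1 + b))
        = ENNReal.ofReal |a⁻¹| • (π.snd.prod volume) := by
      refine Measure.ext_of_lintegral _ fun f hf => ?_
      rw [lintegral_map hf (by fun_prop), lintegral_prod_symm _ (by fun_prop),
        lintegral_smul_measure, lintegral_prod _ hf.aemeasurable, smul_eq_mul,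
        ← lintegral_const_mul _ hf.lintegral_prod_right']
      refine lintegral_congr fun u => ?_
      exact lintegral_comp_affine ha b (h := fun s => f (u, s)) (by fun_prop)
    have h3 : π ≪ (volume : Measure ℝ).prod π.snd :=
      hac.trans ((gaussianReal_absolutelyContinuous m hv).prod .rfl)
    rw [h1]
    refine (h3.map (by fun_prop)).trans ?_
    rw [h2]
    exact Measure.smul_absolutelyContinuous
  · exact (Measure.absolutelyContinuous_of_le (repLaw_le hw)).trans
      Measure.smul_absolutelyContinuous

instance [IsProbabilityMeasure π] : IsProbabilityMeasure (repLaw π a b w) :=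
  Measure.isProbabilityMeasure_map (by fun_prop)

/-- A version of the conditional density with good integrability properties. -/
lemma exists_density_repLaw [IsProbabilityMeasure π] :
    ∃ f : β × ℝ → ℝ, Measurable f ∧ (∀ q, 0 ≤ f q) ∧ (w ≠ 0 → ∃ M, ∀ q, f q ≤ M)
      ∧ (∀ᵐ u ∂π.snd, ∫⁻ s, ENNReal.ofReal (f (u, s)) ≤ 1)
      ∧ (repLaw π a b w ≪ π.snd.prod volume →
        ∀ᵐ q ∂(repLaw π a b w), 0 < f q ∧ condDensity (repLaw π a b w) q = f q) := by
  set ρ := repLaw π a b w with hρ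
  have hfst : ρ.fst = π.snd := fst_repLaw
  have hm : Measurable (ρ.rnDeriv (π.snd.prod volume)) := Measure.measurable_rnDeriv _ _
  have hcond : ∀ q, condDensity ρ q = (ρ.rnDeriv (π.snd.prod volume) q).toReal := by
    intro q; rw [condDensity, hfst]
  have hmarg : ∀ᵐ u ∂π.snd, ∫⁻ s, ρ.rnDeriv (π.snd.prod volume) (u, s) ≤ 1 := by
    have h := lintegral_rnDeriv_fst_prod_le (ρ := ρ)
    rwa [hfst] at h
  have hpos : ρ ≪ π.snd.prod volume →
      ∀ᵐ q ∂ρ, 0 < (ρ.rnDeriv (π.snd.prod volume) q).toReal := by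
    intro hac
    filter_upwards [Measure.rnDeriv_pos hac, hac.ae_le (ρ.rnDeriv_lt_top _)] with q h1 h2
    exact ENNReal.toReal_pos h1.ne' h2.ne
  by_cases hw : w = 0
  · refine ⟨fun q => (ρ.rnDeriv (π.snd.prod volume) q).toReal, hm.ennreal_toReal,
      fun q => ENNReal.toReal_nonneg, fun h => absurd hw h, ?_, fun hac => ?_⟩
    · filter_upwards [hmarg] with u hu
      exact (lintegral_mono fun s => ENNReal.ofReal_toReal_le).trans hu
    · filter_upwards [hpos hac] with q hq using ⟨hq, hcond q⟩
  · set M : ℝ := (√(2 * Real.pi * w))⁻¹ with hM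
    have hMpos : 0 < M := by
      have : (0 : ℝ) < w := by positivity
      positivity
    have hbd : ∀ᵐ q ∂(π.snd.prod volume), ρ.rnDeriv (π.snd.prod volume) q ≤ ENNReal.ofReal M := by
      refine ae_le_of_forall_setLIntegral_le_of_sigmaFinite (g := fun _ => ENNReal.ofReal M)
        hm fun s hs _ => ?_
      rw [setLIntegral_const]
      exact (Measure.setLIntegral_rnDeriv_le s).trans (repLaw_le hw s)
    -- The derivative is at most `M` only almost everywhere; truncation makes the bound hold
    -- everywhere and changes only a null set.
    refine ⟨fun q => min (ρ.rnDeriv (π.snd.prod volume) q).toReal M,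
      hm.ennreal_toReal.min measurable_const,
      fun q => le_min ENNReal.toReal_nonneg hMpos.le, fun _ => ⟨M, fun q => min_le_right _ _⟩,
      ?_, fun hac => ?_⟩
    · filter_upwards [hmarg] with u hu
      exact (lintegral_mono fun s => (ENNReal.ofReal_le_ofReal (min_le_left _ _)).trans
        ENNReal.ofReal_toReal_le).trans hu
    · filter_upwards [hpos hac, hac.ae_le hbd] with q hq hb
      have hle : (ρ.rnDeriv (π.snd.prod volume) q).toReal ≤ M :=
        ENNReal.toReal_le_of_le_ofReal hMpos.le hb
      rw [min_eq_left hle]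
      exact ⟨hq, hcond q⟩

end RepLaw

/-! ### From the dual inequality to a bound on the expected log-density. -/

section EntropyBound

open Set Filter Topology InformationTheory
open scoped NNReal

variable {β : Type*} [MeasurableSpace β] {π : Measure (ℝ × β)} {m a b : ℝ} {v w : ℝ≥0}

/-- The exponent in the dual inequality, including the noiseless case. -/
lemma lintegral_exp_integral_log_le' {l : ℝ} (hl : w ≠ 0 ∧ 0 < l ∧ l < 1 ∨ w = 0 ∧ l = 1)
    {p : ℝ → ℝ} (hpm : Measurable p) (hp : ∀ s, 0 < p s) {c : ℝ}
    (hb : w ≠ 0 → ∀ s, |Real.log (p s)| ≤ c * (1 + s ^ 2))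
    (hp1 : ∫⁻ s, ENNReal.ofReal (p s) ≤ 1) :
    ∫⁻ y, ENNReal.ofReal (Real.exp ((∫ n, Real.log (p (y + n)) ∂(gaussianReal 0 w)) / l))
      ≤ ENNReal.ofReal (Real.exp ((1 / 2 * l * Real.log l + 1 / 2 * (1 - l) * Real.log (1 - l)
        - 1 / 2 * (1 - l) * (Real.log (2 * Real.pi * w) + 1)) / l)) := by
  rcases hl with ⟨hw, hl0, hl1⟩ | ⟨rfl, rfl⟩
  · exact lintegral_exp_integral_log_le hw hl0 hl1 hpm hp (hb hw) hp1
  -- Without noise the Gaussian law is a Dirac mass and the claim reduces to `∫ p ≤ 1`.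
  · have hlogm : Measurable fun s => Real.log (p s) := by fun_prop
    have h : ∀ y, ∫ n, Real.log (p (y + n)) ∂(gaussianReal 0 0) = Real.log (p y) := by
      intro y
      have hy : Measurable fun n => Real.log (p (y + n)) := by fun_prop
      rw [gaussianReal_zero_var, integral_dirac' _ _ hy.stronglyMeasurable, add_zero]
    simp only [h, div_one, Real.exp_log (hp _)]
    simpa using hp1

lemma integrable_comp_fst_of_fst_eq {μ : Measure ℝ} (hπ : π.fst = μ) {f : ℝ → ℝ}
    (hf : Integrable f μ) : Integrable (fun q => f q.1) π := by
  rw [← hπ, Measure.fst] at hf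
  exact hf.comp_measurable measurable_fst

lemma integral_comp_fst_of_fst_eq {μ : Measure ℝ} (hπ : π.fst = μ) {f : ℝ → ℝ}
    (hf : Measurable f) : ∫ q, f q.1 ∂π = ∫ x, f x ∂μ := by
  rw [← hπ, Measure.fst, integral_map measurable_fst.aemeasurable hf.aestronglyMeasurable]

lemma integral_log_gaussianPDFReal (m : ℝ) {v : ℝ≥0} (hv : v ≠ 0) :
    ∫ x, Real.log (gaussianPDFReal m v x) ∂(gaussianReal m v)
      = -(1 / 2) * (Real.log (2 * Real.pi * v) + 1) := by
  have hv' : (0 : ℝ) < v := by positivity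
  have hi : Integrable (fun x : ℝ => (x - m) ^ 2) (gaussianReal m v) :=
    ((memLp_id_gaussianReal' 2 (by simp)).sub (memLp_const m)).integrable_sq
  simp_rw [log_gaussianPDFReal m hv]
  rw [integral_sub (integrable_const _) (hi.div_const _), integral_div,
    integral_sub_sq_gaussianReal]
  simp
  field_simp
  ring

lemma integrable_log_gaussianPDFReal (m m' : ℝ) {v v' : ℝ≥0} (hv : v ≠ 0) :
    Integrable (fun x => Real.log (gaussianPDFReal m v x)) (gaussianReal m' v') := by
  have hi : Integrable (fun x : ℝ => (x - m) ^ 2) (gaussianReal m' v') :=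
    ((memLp_id_gaussianReal' 2 (by simp)).sub (memLp_const m)).integrable_sq
  simp_rw [log_gaussianPDFReal m hv]
  exact (integrable_const _).sub (hi.div_const _)

/-- The contribution of a test density to the conditional entropy of the noisy variable. -/
lemma integral_log_repLaw_le [IsProbabilityMeasure π] (hv : v ≠ 0) (hfst : π.fst = gaussianReal m v)
    (hkl : mutualInfo π ≠ ∞) (ha : a ≠ 0)
    {l : ℝ} (hl : w ≠ 0 ∧ 0 < l ∧ l < 1 ∨ w = 0 ∧ l = 1)
    {f : β × ℝ → ℝ} (hfm : Measurable f) (hf : ∀ q, 0 < f q)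
    {c₀ : ℝ} (hc₀ : c₀ ≤ 0) (hlow : ∀ q, c₀ - q.2 ^ 2 / 2 ≤ Real.log (f q))
    (hup : w ≠ 0 → ∃ M, ∀ q, f q ≤ M)
    (hmarg : ∀ᵐ u ∂π.snd, ∫⁻ s, ENNReal.ofReal (f (u, s)) ≤ 1) :
    Integrable (fun q => Real.log (f q)) (repLaw π a b w) ∧
    ∫ q, Real.log (f q) ∂(repLaw π a b w)
      ≤ l * ((mutualInfo π).toReal - 1 / 2 * (Real.log (2 * Real.pi * v) + 1) - Real.log |a|)
        + (1 / 2 * l * Real.log l + 1 / 2 * (1 - l) * Real.log (1 - l)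
        - 1 / 2 * (1 - l) * (Real.log (2 * Real.pi * w) + 1)) := by
  set K := 1 / 2 * l * Real.log l + 1 / 2 * (1 - l) * Real.log (1 - l)
        - 1 / 2 * (1 - l) * (Real.log (2 * Real.pi * w) + 1) with hK
  have hl0 : 0 < l := by rcases hl with h | h <;> linarith [h.2]
  have hlogm : Measurable fun q => Real.log (f q) := by fun_prop
  -- integrability along the noise
  have hbound : w ≠ 0 → ∃ c, ∀ u s, |Real.log (f (u, s))| ≤ c * (1 + s ^ 2) := by
    intro hw
    obtain ⟨M, hM⟩ := hup hw
    refine ⟨-c₀ + 1 / 2 + |Real.log M|, fun u s => abs_le.2 ⟨?_, ?_⟩⟩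
    · have := hlow (u, s)
      have h1 : 0 ≤ |Real.log M| * (1 + s ^ 2) := by positivity
      have h2 : 0 ≤ -c₀ * s ^ 2 := mul_nonneg (by linarith) (sq_nonneg s)
      simp only at this
      nlinarith
    · have h1 : Real.log (f (u, s)) ≤ Real.log M := Real.log_le_log (hf _) (hM _)
      have h2 : 0 ≤ (-c₀ + 1 / 2) * (1 + s ^ 2) := mul_nonneg (by linarith) (by positivity)
      have h3 : 0 ≤ |Real.log M| * s ^ 2 := by positivity
      nlinarith [le_abs_self (Real.log M)]
  have hnint : ∀ u y, Integrable (fun n => Real.log (f (u, y + n))) (gaussianReal 0 w) := by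
    intro u y
    have hmeas : Measurable fun n => Real.log (f (u, y + n)) := by fun_prop
    by_cases hw : w = 0
    · rw [hw, gaussianReal_zero_var]
      exact integrable_dirac' hmeas.stronglyMeasurable (by simp)
    · obtain ⟨c, hc⟩ := hbound hw
      have hc0 : 0 ≤ c := by simpa using (abs_nonneg _).trans (hc u 0)
      refine Integrable.mono' (g := fun n => c * (1 + 2 * y ^ 2) + 2 * c * n ^ 2)
        ((integrable_const _).add ((integrable_sq_gaussianReal 0 w).const_mul _))
        hmeas.aestronglyMeasurable (ae_of_all _ fun n => ?_)
      rw [Real.norm_eq_abs]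
      refine (hc _ _).trans ?_
      nlinarith [mul_nonneg hc0 (sq_nonneg (y - n))]
  set G : ℝ × β → ℝ := fun q => ∫ n, Real.log (f (q.2, a * q.1 + b + n)) ∂(gaussianReal 0 w)
    with hG
  have hGm : Measurable G := by
    have h : Measurable fun q : (ℝ × β) × ℝ => Real.log (f (q.1.2, a * q.1.1 + b + q.2)) := by
      fun_prop
    exact (h.stronglyMeasurable.integral_prod_right' (ν := gaussianReal 0 w)).measurable
  have hquad : ∀ y : ℝ, Integrable (fun n => c₀ - (y + n) ^ 2 / 2) (gaussianReal 0 w) ∧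
      ∫ n, (c₀ - (y + n) ^ 2 / 2) ∂(gaussianReal 0 w) = c₀ - (y ^ 2 + w) / 2 := by
    intro y
    have e : (fun n : ℝ => c₀ - (y + n) ^ 2 / 2)
        = fun n => (c₀ - y ^ 2 / 2) + (-y) * n + (-1 / 2) * n ^ 2 := by ext n; ring
    have i1 := (integrable_id_gaussianReal 0 w).const_mul (-y)
    have i2 := (integrable_sq_gaussianReal 0 w).const_mul (-1 / 2)
    have i3 : Integrable (fun n => (c₀ - y ^ 2 / 2) + (-y) * n) (gaussianReal 0 w) :=
      (integrable_const _).add i1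
    rw [e]
    refine ⟨i3.add i2, ?_⟩
    rw [integral_add i3 i2, integral_add (integrable_const _) i1, integral_const_mul,
      integral_const_mul, integral_id_gaussianReal, integral_sq_gaussianReal]
    simp
    ring
  have hGlow : ∀ q, c₀ - ((a * q.1 + b) ^ 2 + w) / 2 ≤ G q := by
    intro q
    rw [← (hquad (a * q.1 + b)).2]
    exact integral_mono (hquad _).1 (hnint _ _) fun n => hlow (q.2, a * q.1 + b + n)
  -- the integrability of quadratic functions of the source
  have hsq : Integrable (fun q : ℝ × β => ((a * q.1 + b) ^ 2 + w) / 2) π := by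
    refine integrable_comp_fst_of_fst_eq hfst (f := fun x => ((a * x + b) ^ 2 + w) / 2) ?_
    refine Integrable.div_const (Integrable.add ?_ (integrable_const _)) _
    exact (((memLp_id_gaussianReal' 2 (by simp)).const_mul a).add (memLp_const b)).integrable_sq
  have hlogX : Integrable (fun q : ℝ × β => Real.log (gaussianPDFReal m v q.1)) π :=
    integrable_comp_fst_of_fst_eq hfst (integrable_log_gaussianPDFReal m m hv)
  have hgm : Measurable (gaussianPDFReal m v) := measurable_gaussianPDFReal m v
  -- Subtracting the log-density of `X` turns integration against the law of `X` into Lebesgue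
  -- integration, where the dual inequality applies; the substitution `y = a x + b` costs the `log
  -- |a|`.
  set g : ℝ × β → ℝ := fun q => G q / l - Real.log (gaussianPDFReal m v q.1) with hg
  have hexp : ∫⁻ q, ENNReal.ofReal (Real.exp (g q)) ∂(π.fst.prod π.snd)
      ≤ ENNReal.ofReal (Real.exp (K / l - Real.log |a|)) := by
    rw [lintegral_prod_symm _ (by fun_prop), hfst]
    calc ∫⁻ u, ∫⁻ x, ENNReal.ofReal (Real.exp (g (x, u))) ∂(gaussianReal m v) ∂π.snd
        ≤ ∫⁻ _, ENNReal.ofReal (Real.exp (K / l - Real.log |a|)) ∂π.snd := by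
          refine lintegral_mono_ae ?_
          filter_upwards [hmarg] with u hu
          have h1 : ∫⁻ x, ENNReal.ofReal (Real.exp (g (x, u))) ∂(gaussianReal m v)
              = ∫⁻ x, ENNReal.ofReal (Real.exp (G (x, u) / l)) := by
            rw [lintegral_gaussianReal hv (by fun_prop)]
            refine lintegral_congr fun x => ?_
            have hp := gaussianPDFReal_pos m v x hv
            rw [← ENNReal.ofReal_mul hp.le, hg, Real.exp_sub, Real.exp_log hp,
              mul_div_cancel₀ _ hp.ne']
          have h2 : Measurable fun y => ENNReal.ofReal (Real.exp
              ((∫ n, Real.log (f (u, y + n)) ∂(gaussianReal 0 w)) / l)) := by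
            have h : Measurable fun q : ℝ × ℝ => Real.log (f (u, q.1 + q.2)) := by fun_prop
            have h' := (h.stronglyMeasurable.integral_prod_right'
              (ν := gaussianReal 0 w)).measurable
            fun_prop
          rw [h1]
          refine (lintegral_comp_affine ha b h2).trans_le ?_
          have hcu : ∃ c, w ≠ 0 → ∀ s, |Real.log (f (u, s))| ≤ c * (1 + s ^ 2) := by
            by_cases hw : w = 0
            · exact ⟨0, fun h => absurd hw h⟩
            · obtain ⟨c, hc⟩ := hbound hw
              exact ⟨c, fun _ => hc u⟩
          obtain ⟨c, hc⟩ := hcu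
          refine (mul_le_mul_right (lintegral_exp_integral_log_le' hl
            (p := fun s => f (u, s)) (by fun_prop) (fun s => hf _) hc hu) _).trans (le_of_eq ?_)
          rw [← ENNReal.ofReal_mul (abs_nonneg _), Real.exp_sub, Real.exp_log (abs_pos.2 ha),
            abs_inv, ← hK]
          congr 1
          ring
      _ = _ := by simp
  obtain ⟨hgint, hgle⟩ := integrable_and_integral_le_klDiv hkl (g := g) (by fun_prop) hexp
    (b := fun q => (c₀ - ((a * q.1 + b) ^ 2 + w) / 2) / l - Real.log (gaussianPDFReal m v q.1))
    ((((integrable_const c₀).sub hsq).div_const l).sub hlogX)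
    (fun q => by
      have := hGlow q
      simp only [hg]
      gcongr)
  have hGeq : G = fun q => l * (g q + Real.log (gaussianPDFReal m v q.1)) := by
    ext q; simp only [hg]; field_simp; ring
  have hGint : Integrable G π := by
    rw [hGeq]; exact (hgint.add hlogX).const_mul l
  have hGle : ∫ q, G q ∂π
      ≤ l * ((mutualInfo π).toReal - 1 / 2 * (Real.log (2 * Real.pi * v) + 1) - Real.log |a|)
        + K := by
    have h1 : ∫ q, G q ∂π = l * (∫ q, g q ∂π + -(1 / 2) * (Real.log (2 * Real.pi * v) + 1)) := by
      rw [← integral_log_gaussianPDFReal m hv,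
        ← integral_comp_fst_of_fst_eq hfst (f := fun x => Real.log (gaussianPDFReal m v x))
          (by fun_prop), ← integral_add hgint hlogX, ← integral_const_mul, ← hGeq]
    rw [h1]
    have h2 : l * (K / l) = K := by field_simp
    have h3 := mul_le_mul_of_nonneg_left hgle hl0.le
    change l * _ ≤ l * ((mutualInfo π).toReal + (K / l - Real.log |a|)) at h3
    linarith
  have hmap : Measurable fun q : (ℝ × β) × ℝ => (q.1.2, a * q.1.1 + b + q.2) := by fun_prop
  have hjm : Measurable fun q : (ℝ × β) × ℝ => Real.log (f (q.1.2, a * q.1.1 + b + q.2)) := by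
    fun_prop
  have hjint : Integrable (fun q : (ℝ × β) × ℝ => Real.log (f (q.1.2, a * q.1.1 + b + q.2)))
      (π.prod (gaussianReal 0 w)) := by
    rw [integrable_prod_iff hjm.aestronglyMeasurable]
    refine ⟨ae_of_all _ fun q => hnint q.2 (a * q.1 + b), ?_⟩
    -- A number `x` with a lower bound `k ≤ 0` satisfies `|x| ≤ x - 2k`; here `k` is the quadratic
    -- minorant.
    refine Integrable.mono'
      (g := fun q => G q - 2 * (c₀ - ((a * q.1 + b) ^ 2 + w) / 2))
      (hGint.sub (((integrable_const c₀).sub hsq).const_mul 2))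
      (hjm.norm.stronglyMeasurable.integral_prod_right' (ν := gaussianReal 0 w)).aestronglyMeasurable
      (ae_of_all _ fun q => ?_)
    rw [Real.norm_of_nonneg (integral_nonneg fun _ => norm_nonneg _), ← (hquad _).2, hG,
      ← integral_const_mul, ← integral_sub (hnint _ _) ((hquad _).1.const_mul 2)]
    refine integral_mono (hnint q.2 (a * q.1 + b)).norm ((hnint q.2 (a * q.1 + b)).sub ((hquad _).1.const_mul 2)) fun n => ?_
    have h1 := hlow (q.2, a * q.1 + b + n)
    have h2 : c₀ - (a * q.1 + b + n) ^ 2 / 2 ≤ 0 := by nlinarith [sq_nonneg (a * q.1 + b + n)]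
    simp only [Real.norm_eq_abs]
    simp only at h1
    rw [abs_le]
    constructor <;> linarith
  constructor
  · rw [repLaw, integrable_map_measure hlogm.aestronglyMeasurable hmap.aemeasurable]
    exact hjint
  · rw [repLaw, integral_map hmap.aemeasurable hlogm.aestronglyMeasurable, integral_prod _ hjint]
    exact hGle

end EntropyBound

/-! ### Lower bounds on conditional entropy and on distortion. -/

section LowerBounds

open Set Filter Topology InformationTheory
open scoped NNReal

variable {β : Type*} [MeasurableSpace β] {π : Measure (ℝ × β)} {m a b : ℝ} {v w : ℝ≥0}

lemma repLaw_zero_left : repLaw π 0 b w = noisyGraph π.snd (fun _ => b) w := by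
  refine Measure.ext_of_lintegral _ fun f hf => ?_
  have hm : Measurable fun u => ∫⁻ s, f (u, s) ∂(gaussianReal b w) := hf.lintegral_prod_right'
  rw [lintegral_repLaw hf, lintegral_noisyGraph measurable_const hf, Measure.snd,
    lintegral_map hm measurable_snd]
  simp

/-- A lower bound on the conditional entropy of a noisy Gaussian variable in terms of the mutual
information between the noiseless variable and the observation. -/
theorem le_condEntropy_repLaw [IsProbabilityMeasure π] (hv : v ≠ 0)
    (hfst : π.fst = gaussianReal m v) (hkl : mutualInfo π ≠ ∞) (haw : a ≠ 0 ∨ w ≠ 0) :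
    ((1 / 2 * (Real.log (2 * Real.pi
      * (a ^ 2 * (v * Real.exp (-2 * (mutualInfo π).toReal)) + w)) + 1) : ℝ) : EReal)
      ≤ condEntropy (repLaw π a b w) := by
  have hv' : (0 : ℝ) < v := by positivity
  by_cases ha : a = 0
  · have hw := haw.resolve_left (not_not.2 ha)
    rw [ha, repLaw_zero_left, condEntropy_noisyGraph measurable_const hw]
    simp
  have hac0 : π ≪ (gaussianReal m v).prod π.snd := by
    rw [← hfst]; exact (klDiv_ne_top_iff.1 hkl).1
  have hac := repLaw_absolutelyContinuous (b := b) hv hac0 haw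
  obtain ⟨f, hfm, hf0, hfup, hfmarg, hfeq⟩ := exists_density_repLaw (π := π) (a := a) (b := b)
    (w := w)
  set I := (mutualInfo π).toReal with hI
  set A := a ^ 2 * (v * Real.exp (-2 * I)) with hA
  have hApos : 0 < A := by positivity
  set T := 1 / 2 * (Real.log (2 * Real.pi * (A + w)) + 1) with hT
  have hw0 : (0 : ℝ) ≤ w := w.2
  -- For this exponent the bound of `integral_log_repLaw_le` is exactly `-T`. It equals `1`
  -- precisely when there is no noise.
  set l := A / (A + w) with hl
  have hlog : l * (I - 1 / 2 * (Real.log (2 * Real.pi * v) + 1) - Real.log |a|)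
        + (1 / 2 * l * Real.log l + 1 / 2 * (1 - l) * Real.log (1 - l)
        - 1 / 2 * (1 - l) * (Real.log (2 * Real.pi * w) + 1)) = -T := by
    have hlogA : Real.log A = 2 * Real.log |a| + Real.log v - 2 * I := by
      rw [hA, Real.log_mul (by positivity) (by positivity), Real.log_mul hv'.ne' (by positivity),
        Real.log_exp, ← sq_abs, Real.log_pow]
      push_cast; ring
    have hpi : (2 * Real.pi) ≠ 0 := by positivity
    rw [hT, Real.log_mul hpi hv'.ne', Real.log_mul hpi (by positivity : A + w ≠ 0)]
    by_cases hw : w = 0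
    · have hl1 : l = 1 := by rw [hl, hw]; simp [hApos.ne']
      rw [hl1, hw]
      simp only [NNReal.coe_zero, add_zero]
      rw [hlogA]
      simp
      ring
    · have hw' : (0 : ℝ) < w := by positivity
      have h1l : 1 - l = w / (A + w) := by rw [hl]; field_simp; ring
      rw [Real.log_mul hpi hw'.ne', h1l, Real.log_div hw'.ne' (by positivity), ← h1l, hl,
        Real.log_div hApos.ne' (by positivity), ← hl]
      linear_combination (1 / 2) * l * hlogA
  have hlcase : w ≠ 0 ∧ 0 < l ∧ l < 1 ∨ w = 0 ∧ l = 1 := by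
    by_cases hw : w = 0
    · right; exact ⟨hw, by rw [hl, hw]; simp [hApos.ne']⟩
    · have hw' : (0 : ℝ) < w := by positivity
      left
      exact ⟨hw, by positivity, by rw [hl, div_lt_one (by positivity)]; linarith⟩
  have hψm : Measurable (gaussianPDFReal 0 1) := measurable_gaussianPDFReal 0 1
  have key : ∀ ε : ℝ, 0 < ε → ((T - ε : ℝ) : EReal) ≤ condEntropy (repLaw π a b w) := by
    intro ε hε
    -- Mixing with a Gaussian density gives the logarithm a quadratic lower bound and keeps the
    -- fibre mass at most `1`; since `f ≤ (1 + ε) f'`, the entropy bound loses at most `log (1 + ε)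
    -- ≤ ε`.
    set f' : β × ℝ → ℝ := fun q => (f q + ε * gaussianPDFReal 0 1 q.2) / (1 + ε) with hf'
    have hψ : ∀ s, 0 < gaussianPDFReal 0 1 s := fun s => gaussianPDFReal_pos 0 1 s one_ne_zero
    have hpos : ∀ q, 0 < f' q := fun q =>
      div_pos (add_pos_of_nonneg_of_pos (hf0 q) (mul_pos hε (hψ _))) (by linarith)
    have hf'm : Measurable f' := by fun_prop
    have hup : w ≠ 0 → ∃ M, ∀ q, f' q ≤ M := by
      intro hw
      obtain ⟨M, hM⟩ := hfup hw
      refine ⟨(M + ε * 1) / (1 + ε), fun q => ?_⟩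
      have h1 : gaussianPDFReal 0 1 q.2 ≤ 1 := by
        rw [← Real.log_nonpos_iff (hψ _).le, log_gaussianPDFReal _ one_ne_zero]
        have h2 : 0 ≤ Real.log (2 * Real.pi * ((1 : ℝ≥0) : ℝ)) :=
          Real.log_nonneg (by simp; linarith [Real.pi_gt_three])
        have h3 : 0 ≤ (q.2 - 0) ^ 2 / (2 * ((1 : ℝ≥0) : ℝ)) := by positivity
        linarith
      simp only [hf']
      gcongr
      exact hM q
    have hlow : ∀ q, (Real.log (ε / (1 + ε)) - 1 / 2 * Real.log (2 * Real.pi)) - q.2 ^ 2 / 2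
        ≤ Real.log (f' q) := by
      intro q
      have h1 : Real.log (ε / (1 + ε) * gaussianPDFReal 0 1 q.2) ≤ Real.log (f' q) := by
        refine Real.log_le_log (mul_pos (by positivity) (hψ _)) ?_
        simp only [hf', div_mul_eq_mul_div]
        gcongr
        linarith [hf0 q]
      rw [Real.log_mul (by positivity) (hψ _).ne', log_gaussianPDFReal _ one_ne_zero] at h1
      simp only [NNReal.coe_one, mul_one, sub_zero] at h1
      linarith
    have hc₀ : Real.log (ε / (1 + ε)) - 1 / 2 * Real.log (2 * Real.pi) ≤ 0 := by
      have h1 : Real.log (ε / (1 + ε)) ≤ 0 := Real.log_nonpos (by positivity)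
        ((div_le_one (by linarith)).2 (by linarith))
      have h2 : 0 ≤ Real.log (2 * Real.pi) := Real.log_nonneg (by linarith [Real.pi_gt_three])
      linarith
    have hmarg : ∀ᵐ u ∂π.snd, ∫⁻ s, ENNReal.ofReal (f' (u, s)) ≤ 1 := by
      filter_upwards [hfmarg] with u hu
      have h1 : ∀ s, ENNReal.ofReal (f' (u, s)) = (ENNReal.ofReal (f (u, s))
          + ENNReal.ofReal ε * ENNReal.ofReal (gaussianPDFReal 0 1 s))
            * ENNReal.ofReal (1 + ε)⁻¹ := by
        intro s
        rw [← ENNReal.ofReal_mul hε.le, ← ENNReal.ofReal_add (hf0 _) (by have := hψ s; positivity),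
          ← ENNReal.ofReal_mul (add_nonneg (hf0 _) (by have := hψ s; positivity))]
        rfl
      simp_rw [h1]
      rw [lintegral_mul_const _ (by fun_prop), lintegral_add_left (by fun_prop),
        lintegral_const_mul _ (by fun_prop), lintegral_gaussianPDFReal_eq_one _ one_ne_zero,
        mul_one]
      calc _ ≤ (1 + ENNReal.ofReal ε) * ENNReal.ofReal (1 + ε)⁻¹ := by gcongr
        _ = 1 := by
          rw [← ENNReal.ofReal_one, ← ENNReal.ofReal_add zero_le_one hε.le,
            ← ENNReal.ofReal_mul (by linarith), mul_inv_cancel₀ (by linarith)]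
    obtain ⟨hint, hle⟩ := integral_log_repLaw_le (b := b) hv hfst hkl ha hlcase hf'm hpos hc₀ hlow
      hup hmarg
    rw [hlog] at hle
    have hF : Integrable (fun q => -Real.log (f' q) - ε) (repLaw π a b w) :=
      hint.neg.sub (integrable_const ε)
    refine le_trans ?_ (le_condEntropy (f := fun q => -Real.log (f' q) - ε)
      (by rwa [fst_repLaw]) hF ?_)
    · rw [EReal.coe_le_coe_iff, integral_sub hint.fun_neg (integrable_const ε), integral_neg]
      simp
      linarith
    · filter_upwards [hfeq hac] with q hq
      rw [hq.2]
      have h1 : Real.log (f q) ≤ Real.log ((1 + ε) * f' q) := by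
        refine Real.log_le_log hq.1 ?_
        rw [hf', mul_div_cancel₀ _ (by linarith)]
        have := mul_pos hε (hψ q.2)
        linarith
      rw [Real.log_mul (by linarith) (hpos q).ne'] at h1
      have h2 : Real.log (1 + ε) ≤ ε := by
        have := Real.log_le_sub_one_of_pos (by linarith : 0 < 1 + ε)
        linarith
      linarith
  induction hH : condEntropy (repLaw π a b w) using EReal.rec with
  | bot =>
    have := key 1 one_pos
    rw [hH, le_bot_iff] at this
    exact absurd this (EReal.coe_ne_bot _)
  | top => exact le_top
  | coe h =>
    rw [EReal.coe_le_coe_iff]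
    refine le_of_forall_pos_le_add fun ε hε => ?_
    have := key ε hε
    rw [hH, EReal.coe_le_coe_iff] at this
    linarith

/-- The Gaussian rate-distortion bound. -/
theorem ofReal_le_lintegral_sq_sub {π : Measure (ℝ × ℝ)} [IsProbabilityMeasure π] (hv : v ≠ 0)
    (hfst : π.fst = gaussianReal m v) (hkl : mutualInfo π ≠ ∞) :
    ENNReal.ofReal (v * Real.exp (-2 * (mutualInfo π).toReal))
      ≤ ∫⁻ q, ENNReal.ofReal ((q.1 - q.2) ^ 2) ∂π := by
  have hv' : (0 : ℝ) < v := by positivity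
  by_cases htop : ∫⁻ q, ENNReal.ofReal ((q.1 - q.2) ^ 2) ∂π = ∞
  · rw [htop]; exact le_top
  set I := (mutualInfo π).toReal with hI
  -- The test function is the log-ratio of the `N(X̂, t)` density to that of `X`; its exponential
  -- integrates to `1` under the product law. This `t` cancels `I` and leaves `½ ≤ E[(X - X̂)²] /
  -- (2t)`.
  set t : ℝ≥0 := v * (Real.exp (-2 * I)).toNNReal with ht
  have htv : (t : ℝ) = v * Real.exp (-2 * I) := by
    rw [ht, NNReal.coe_mul, Real.coe_toNNReal _ (Real.exp_pos _).le]
  have ht' : (0 : ℝ) < t := by rw [htv]; positivity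
  have ht0 : t ≠ 0 := by exact_mod_cast ht'.ne'
  have hsq : Integrable (fun q : ℝ × ℝ => (q.1 - q.2) ^ 2) π := by
    refine ⟨by fun_prop, ?_⟩
    rw [hasFiniteIntegral_iff_ofReal (ae_of_all _ fun q => sq_nonneg _)]
    exact lt_top_iff_ne_top.2 htop
  have hlogX : Integrable (fun q : ℝ × ℝ => Real.log (gaussianPDFReal m v q.1)) π :=
    integrable_comp_fst_of_fst_eq hfst (integrable_log_gaussianPDFReal m m hv)
  have hgm : Measurable (gaussianPDFReal m v) := measurable_gaussianPDFReal m v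
  have hgm' : Measurable fun q : ℝ × ℝ => gaussianPDFReal q.2 t q.1 :=
    measurable_uncurry_gaussianPDFReal.comp
      (measurable_snd.prodMk (measurable_const.prodMk measurable_fst))
  have hlogt : Integrable (fun q : ℝ × ℝ => Real.log (gaussianPDFReal q.2 t q.1)) π := by
    simp_rw [log_gaussianPDFReal _ ht0]
    exact (integrable_const _).sub (hsq.div_const _)
  have hexp : ∫⁻ q : ℝ × ℝ, ENNReal.ofReal (Real.exp (Real.log (gaussianPDFReal q.2 t q.1)
      - Real.log (gaussianPDFReal m v q.1))) ∂(π.fst.prod π.snd)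
      ≤ ENNReal.ofReal (Real.exp 0) := by
    rw [lintegral_prod_symm _ (by fun_prop), hfst]
    refine le_of_eq ?_
    have h1 : ∀ u : ℝ, ∫⁻ x, ENNReal.ofReal (Real.exp (Real.log (gaussianPDFReal u t x)
        - Real.log (gaussianPDFReal m v x))) ∂(gaussianReal m v) = 1 := by
      intro u
      have hgmu : Measurable (gaussianPDFReal u t) := measurable_gaussianPDFReal u t
      rw [lintegral_gaussianReal hv (by fun_prop), ← lintegral_gaussianPDFReal_eq_one u ht0]
      refine lintegral_congr fun x => ?_
      have hp := gaussianPDFReal_pos m v x hv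
      rw [← ENNReal.ofReal_mul hp.le, Real.exp_sub, Real.exp_log hp,
        Real.exp_log (gaussianPDFReal_pos u t x ht0), mul_div_cancel₀ _ hp.ne']
    simp [h1]
  have h := (integrable_and_integral_le_klDiv hkl (by fun_prop) hexp (hlogt.sub hlogX)
    (fun q => le_rfl)).2
  rw [integral_sub hlogt hlogX,
    integral_comp_fst_of_fst_eq hfst (f := fun x => Real.log (gaussianPDFReal m v x))
      (by fun_prop), integral_log_gaussianPDFReal m hv] at h
  simp_rw [log_gaussianPDFReal _ ht0] at h
  rw [integral_sub (integrable_const _) (hsq.div_const _), integral_div] at h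
  rw [← ofReal_integral_eq_lintegral_ofReal hsq (ae_of_all _ fun q => sq_nonneg _)]
  refine ENNReal.ofReal_le_ofReal ?_
  have hlog : Real.log (2 * Real.pi * t) = Real.log (2 * Real.pi * v) - 2 * I := by
    rw [htv, ← mul_assoc, Real.log_mul (by positivity) (Real.exp_pos _).ne', Real.log_exp]
    ring
  rw [hlog] at h
  simp only [integral_const, probReal_univ, one_smul] at h
  change _ ≤ I + 0 at h
  rw [← htv]
  have h2 : 1 / 2 ≤ (∫ q, (q.1 - q.2) ^ 2 ∂π) / (2 * t) := by linarith
  rw [le_div_iff₀ (by positivity)] at h2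
  linarith

end LowerBounds

/-! ### Gaussian backward test channels and their optimality. -/

section TestChannel

open Set Filter Topology InformationTheory
open scoped NNReal

/-- Data processing: the decoder acts as the same kernel on the joint law and on the product of its
marginals, and divergence decreases under kernels. -/
lemma mutualInfo_comp_le {α β γ : Type*} [MeasurableSpace α] [MeasurableSpace β]
    [MeasurableSpace γ] (μ : Measure α) [IsProbabilityMeasure μ] (κ : Kernel α β) [IsMarkovKernel κ]
    (δ : Kernel β γ) [IsMarkovKernel δ] :
    mutualInfo (μ ⊗ₘ (δ ∘ₖ κ)) ≤ mutualInfo (μ ⊗ₘ κ) := by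
  rw [mutualInfo, mutualInfo, Measure.fst_compProd, Measure.fst_compProd, Measure.snd_compProd,
    Measure.snd_compProd, ← Measure.parallelComp_comp_compProd, ← Measure.comp_assoc,
    Measure.prod_comp_right]
  exact klDiv_comp_right_le _ _ _

/-- The law of `(X, Z)` where `X = g Z + N`, with `Z ∼ η` and an independent Gaussian noise `N` of
variance `t`. -/
noncomputable def testChannel {β : Type*} [MeasurableSpace β] (η : Measure β) (g : β → ℝ)
    (t : ℝ≥0) : Measure (ℝ × β) :=
  (noisyGraph η g t).map Prod.swap

variable {β : Type*} [MeasurableSpace β] {η : Measure β} {g : β → ℝ} {t v w : ℝ≥0} {m a b : ℝ}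

lemma snd_testChannel (hg : Measurable g) : (testChannel η g t).snd = η := by
  rw [testChannel, Measure.snd_map_swap, fst_noisyGraph hg]

lemma lintegral_testChannel (hg : Measurable g) {f : ℝ × β → ℝ≥0∞} (hf : Measurable f) :
    ∫⁻ q, f q ∂(testChannel η g t) = ∫⁻ u, ∫⁻ x, f (x, u) ∂(gaussianReal (g u) t) ∂η := by
  rw [testChannel, lintegral_map hf measurable_swap, lintegral_noisyGraph hg (by fun_prop)]
  rfl

lemma testChannel_eq_map (hg : Measurable g) :
    testChannel η g t = (η.prod (gaussianReal 0 t)).map (fun q => (g q.1 + q.2, q.1)) := by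
  rw [testChannel, noisyGraph, Measure.map_map measurable_swap (by fun_prop)]
  rfl

lemma isProbabilityMeasure_testChannel [IsProbabilityMeasure η] (hg : Measurable g) :
    IsProbabilityMeasure (testChannel η g t) := by
  rw [testChannel_eq_map hg]
  exact Measure.isProbabilityMeasure_map (by fun_prop)

/-- The graph `x = g z` carries all the joint mass but is null for the product law, as `X` has no
atoms. Finite rate therefore forces `t ≠ 0`. -/
lemma mutualInfo_testChannel_zero [IsProbabilityMeasure η] (hg : Measurable g) (hv : v ≠ 0)
    (hfst : (testChannel η g 0).fst = gaussianReal m v) : mutualInfo (testChannel η g 0) = ∞ := by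
  refine klDiv_of_not_ac fun hac => ?_
  have hs : MeasurableSet {q : ℝ × β | q.1 = g q.2} :=
    measurableSet_eq_fun measurable_fst (hg.comp measurable_snd)
  have h0 : ((testChannel η g 0).fst.prod (testChannel η g 0).snd) {q : ℝ × β | q.1 = g q.2}
      = 0 := by
    have := nullSingletonClass_gaussianReal (μ := m) hv
    rw [hfst, snd_testChannel hg, Measure.prod_apply_symm hs]
    simp
  have h1 := hac h0
  have h2 : (testChannel η g 0) {q : ℝ × β | q.1 = g q.2} = 1 := by
    rw [← lintegral_indicator_one hs,
      lintegral_testChannel hg (measurable_one.indicator hs)]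
    simp
  rw [h1] at h2
  exact zero_ne_one h2

/-- The information density is the log-ratio of the `N(g Z, t)` density to that of `X`, with mean `½
log (v / t)`. -/
lemma mutualInfo_testChannel [IsProbabilityMeasure η] (hg : Measurable g) (hv : v ≠ 0)
    (ht : t ≠ 0) (hfst : (testChannel η g t).fst = gaussianReal m v) :
    mutualInfo (testChannel η g t) ≠ ∞ ∧
      v * Real.exp (-2 * (mutualInfo (testChannel η g t)).toReal) = t := by
  have hv' : (0 : ℝ) < v := by positivity
  have ht' : (0 : ℝ) < t := by positivity
  have := isProbabilityMeasure_testChannel (t := t) (η := η) hg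
  set π := testChannel η g t with hπ
  have hsnd : π.snd = η := snd_testChannel hg
  have hgm : Measurable (gaussianPDFReal m v) := measurable_gaussianPDFReal m v
  have hgm' : Measurable fun q : ℝ × β => gaussianPDFReal (g q.2) t q.1 :=
    measurable_uncurry_gaussianPDFReal.comp
      ((hg.comp measurable_snd).prodMk (measurable_const.prodMk measurable_fst))
  set r : ℝ × β → ℝ := fun q => gaussianPDFReal (g q.2) t q.1 / gaussianPDFReal m v q.1 with hr
  have hrm : Measurable fun q => ENNReal.ofReal (r q) := by fun_prop
  have hrpos : ∀ q, 0 < r q := fun q =>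
    div_pos (gaussianPDFReal_pos _ _ _ ht) (gaussianPDFReal_pos _ _ _ hv)
  have hden : π = (π.fst.prod π.snd).withDensity fun q => ENNReal.ofReal (r q) := by
    refine Measure.ext_of_lintegral _ fun f hf => ?_
    rw [lintegral_withDensity_eq_lintegral_mul _ hrm hf, hfst, hsnd,
      lintegral_prod_symm _ (hrm.mul hf).aemeasurable, hπ, lintegral_testChannel hg hf]
    refine lintegral_congr fun u => ?_
    have h2 : Measurable fun x : ℝ => ((fun q => ENNReal.ofReal (r q)) * f) (x, u) :=
      (hrm.mul hf).comp measurable_prodMk_right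
    rw [lintegral_gaussianReal ht (by fun_prop), lintegral_gaussianReal hv h2]
    refine lintegral_congr fun x => ?_
    have hp := gaussianPDFReal_pos m v x hv
    rw [Pi.mul_apply, ← mul_assoc, ← ENNReal.ofReal_mul hp.le, hr, mul_div_cancel₀ _ hp.ne']
  have hac : π ≪ π.fst.prod π.snd := by
    conv_lhs => rw [hden]
    exact withDensity_absolutelyContinuous _ _
  have hllr : llr π (π.fst.prod π.snd) =ᵐ[π] fun q =>
      Real.log (gaussianPDFReal (g q.2) t q.1) - Real.log (gaussianPDFReal m v q.1) := by
    have h := Measure.rnDeriv_withDensity (π.fst.prod π.snd) hrm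
    rw [← hden] at h
    filter_upwards [hac.ae_le h] with q hq
    rw [llr, hq, ENNReal.toReal_ofReal (hrpos q).le, hr,
      Real.log_div (gaussianPDFReal_pos _ _ _ ht).ne' (gaussianPDFReal_pos _ _ _ hv).ne']
  have hlogX : Integrable (fun q : ℝ × β => Real.log (gaussianPDFReal m v q.1)) π :=
    integrable_comp_fst_of_fst_eq hfst (integrable_log_gaussianPDFReal m m hv)
  have hmap : Measurable fun q : β × ℝ => (g q.1 + q.2, q.1) := by fun_prop
  have hsq : Integrable (fun q : β × ℝ => q.2 ^ 2) (η.prod (gaussianReal 0 t)) :=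
    (integrable_sq_gaussianReal 0 t).comp_snd η
  have hlogm : Measurable fun q : ℝ × β => Real.log (gaussianPDFReal (g q.2) t q.1) := by fun_prop
  have hlogt : Integrable (fun q : ℝ × β => Real.log (gaussianPDFReal (g q.2) t q.1)) π := by
    rw [hπ, testChannel_eq_map hg,
      integrable_map_measure hlogm.aestronglyMeasurable hmap.aemeasurable]
    simp only [Function.comp_def, log_gaussianPDFReal _ ht, add_sub_cancel_left]
    exact (integrable_const _).sub (hsq.div_const _)
  have hlogtv : ∫ q, Real.log (gaussianPDFReal (g q.2) t q.1) ∂π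
      = -(1 / 2) * (Real.log (2 * Real.pi * t) + 1) := by
    rw [hπ, testChannel_eq_map hg, integral_map hmap.aemeasurable hlogm.aestronglyMeasurable]
    simp only [log_gaussianPDFReal _ ht, add_sub_cancel_left]
    rw [integral_sub (integrable_const _) (hsq.div_const _), integral_div,
      integral_fun_snd (f := fun n : ℝ => n ^ 2), integral_sq_gaussianReal]
    simp
    field_simp
    ring
  have hint : Integrable (llr π (π.fst.prod π.snd)) π :=
    (integrable_congr hllr).2 (hlogt.sub hlogX)
  have hval : (mutualInfo π).toReal
      = 1 / 2 * (Real.log (2 * Real.pi * v) - Real.log (2 * Real.pi * t)) := by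
    rw [mutualInfo, toReal_klDiv_of_measure_eq hac (by simp), integral_congr_ae hllr,
      integral_sub hlogt hlogX, hlogtv,
      integral_comp_fst_of_fst_eq hfst (f := fun x => Real.log (gaussianPDFReal m v x))
        (by fun_prop), integral_log_gaussianPDFReal m hv]
    ring
  refine ⟨klDiv_ne_top hac hint, ?_⟩
  rw [hval, Real.log_mul (by positivity) hv'.ne', Real.log_mul (by positivity) ht'.ne']
  have e : -2 * (1 / 2 * (Real.log (2 * Real.pi) + Real.log v
      - (Real.log (2 * Real.pi) + Real.log t))) = Real.log t - Real.log v := by ring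
  rw [e, Real.exp_sub, Real.exp_log ht', Real.exp_log hv', mul_div_cancel₀ _ hv'.ne']

/-- Replacing `Z` by `g Z` keeps the backward channel and its noise variance, so the decoder `g`
reduces everything to `X = X̂ + N'`. -/
lemma testChannel_map (hg : Measurable g) :
    (testChannel η g t).map (Prod.map id g) = testChannel (η.map g) id t := by
  refine Measure.ext_of_lintegral _ fun f hf => ?_
  have hm : Measurable fun u : ℝ => ∫⁻ x, f (x, u) ∂(gaussianReal u t) := by
    have e : (fun u : ℝ => ∫⁻ x, f (x, u) ∂(gaussianReal u t))
        = fun u : ℝ => ∫⁻ n, f (u + n, u) ∂(gaussianReal 0 t) := by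
      ext u
      rw [← lintegral_map (f := fun x => f (x, u)) (g := fun n => u + n)
        (by fun_prop) (by fun_prop), gaussianReal_map_const_add, zero_add]
    rw [e]
    have : Measurable fun q : ℝ × ℝ => f (q.1 + q.2, q.1) := by fun_prop
    exact this.lintegral_prod_right'
  rw [lintegral_map hf (by fun_prop), lintegral_testChannel hg (by fun_prop),
    lintegral_testChannel measurable_id hf]
  simp only [id]
  rw [lintegral_map hm hg]
  rfl

lemma lintegral_sq_testChannel {η : Measure ℝ} [IsProbabilityMeasure η] :
    ∫⁻ q, ENNReal.ofReal ((q.1 - q.2) ^ 2) ∂(testChannel η id t) = t := by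
  rw [lintegral_testChannel measurable_id (by fun_prop)]
  have h : ∀ u : ℝ, ∫⁻ x, ENNReal.ofReal ((x - u) ^ 2) ∂(gaussianReal u t) = t := by
    intro u
    have hi : Integrable (fun x : ℝ => (x - u) ^ 2) (gaussianReal u t) :=
      ((memLp_id_gaussianReal' 2 (by simp)).sub (memLp_const u)).integrable_sq
    rw [← ofReal_integral_eq_lintegral_ofReal hi (ae_of_all _ fun x => sq_nonneg _),
      integral_sub_sq_gaussianReal]
    simp
  simp [h]

lemma map_affine_prod_gaussianReal (c a b : ℝ) (t w : ℝ≥0) :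
    ((gaussianReal 0 t).prod (gaussianReal 0 w)).map (fun q => a * (c + q.1) + b + q.2)
      = gaussianReal (a * c + b) (NNReal.mk (a ^ 2) (sq_nonneg a) * t + w) := by
  have h1 : (gaussianReal 0 t).map (fun x => a * (c + x) + b)
      = gaussianReal (a * c + b) (NNReal.mk (a ^ 2) (sq_nonneg a) * t) := by
    have e : (fun x : ℝ => a * (c + x) + b) = (fun x => (a * c + b) + x) ∘ (fun x => a * x) := by
      ext x; simp; ring
    rw [e, ← Measure.map_map (by fun_prop) (by fun_prop), gaussianReal_map_const_mul,
      gaussianReal_map_const_add]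
    simp
  have h2 := gaussianReal_conv_gaussianReal (m₁ := a * c + b) (m₂ := 0)
    (v₁ := NNReal.mk (a ^ 2) (sq_nonneg a) * t) (v₂ := w)
  rw [add_zero] at h2
  rw [← h2, ← h1, Measure.conv]
  have h3 := Measure.map_prod_map (gaussianReal 0 t) (gaussianReal 0 w)
    (f := fun x => a * (c + x) + b) (g := id) (by fun_prop) measurable_id
  rw [Measure.map_id] at h3
  rw [h3, Measure.map_map (by fun_prop) (by fun_prop)]
  rfl

/-- The backward noise, scaled by `a`, and the noise of `S` are independent Gaussians, so their
variances add to `a² t + w`. -/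
lemma repLaw_testChannel {η : Measure ℝ} :
    repLaw (testChannel η id t) a b w
      = noisyGraph η (fun u => a * u + b) (NNReal.mk (a ^ 2) (sq_nonneg a) * t + w) := by
  refine Measure.ext_of_lintegral _ fun f hf => ?_
  have hm : Measurable fun q : (ℝ × ℝ) × ℝ => f (q.1.2, a * q.1.1 + b + q.2) := by fun_prop
  rw [repLaw, lintegral_map hf (by fun_prop), lintegral_prod _ hm.aemeasurable,
    lintegral_testChannel measurable_id hm.lintegral_prod_right',
    lintegral_noisyGraph (by fun_prop) hf]
  refine lintegral_congr fun u => ?_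
  rw [← map_affine_prod_gaussianReal, lintegral_map (by fun_prop) (by fun_prop),
    lintegral_prod _ (by fun_prop)]
  simp only [id]
  have hm2 : Measurable fun x : ℝ => ∫⁻ n, f (u, a * x + b + n) ∂(gaussianReal 0 w) := by
    have : Measurable fun q : ℝ × ℝ => f (u, a * q.1 + b + q.2) := by fun_prop
    exact this.lintegral_prod_right'
  rw [← lintegral_map (f := fun x => ∫⁻ n, f (u, a * x + b + n) ∂(gaussianReal 0 w))
    (g := fun x => u + x) hm2 (by fun_prop), gaussianReal_map_const_add, zero_add]

/-- The rate region of a Gaussian source is bounded by the Gaussian test channels. -/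
theorem bounds_of_mem_rateRegion (hv : v ≠ 0) (haw : a ≠ 0 ∨ w ≠ 0) {R : ℝ≥0∞} (hR : R ≠ ∞)
    {p : ℝ × ℝ}
    (hp : p ∈ rateRegion (noisyGraph (gaussianReal m v) (fun x => a * x + b) w) R) :
    v * Real.exp (-2 * R.toReal) ≤ p.1 ∧
      1 / 2 * (Real.log (2 * Real.pi * (a ^ 2 * (v * Real.exp (-2 * R.toReal)) + w)) + 1)
        ≤ p.2 := by
  have hv' : (0 : ℝ) < v := by positivity
  have hw0 : (0 : ℝ) ≤ w := w.2
  have hg : Measurable fun x : ℝ => a * x + b := by fun_prop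
  have hApos : ∀ s : ℝ, 0 < a ^ 2 * (v * Real.exp (-2 * s)) + w := by
    intro s
    rcases haw with ha | hw
    · positivity
    · have : (0 : ℝ) < w := by positivity
      positivity
  have key : ∀ ε > 0, v * Real.exp (-2 * (R.toReal + ε)) ≤ p.1 ∧
      1 / 2 * (Real.log (2 * Real.pi * (a ^ 2 * (v * Real.exp (-2 * (R.toReal + ε))) + w)) + 1)
        ≤ p.2 := by
    intro ε hε
    -- The infimum defining the rate need not be attained; a near-optimal channel of rate below `R +
    -- ε` is used, and `ε → 0` by continuity.
    have hlt : rate (noisyGraph (gaussianReal m v) (fun x => a * x + b) w) p.1 p.2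
        < R + ENNReal.ofReal ε :=
      lt_of_le_of_lt hp (ENNReal.lt_add_right hR (by simpa using hε))
    simp only [rate, iInf_lt_iff] at hlt
    obtain ⟨κ, hκ, ⟨hmse, hent⟩, hI⟩ := hlt
    rw [lawSourceRep_noisyGraph hg] at hI
    rw [lawRepClass_noisyGraph] at hent
    rw [mse, lawSourceRep_noisyGraph hg] at hmse
    have hfst : ((gaussianReal m v) ⊗ₘ κ).fst = gaussianReal m v := Measure.fst_compProd _ _
    have hfin : mutualInfo ((gaussianReal m v) ⊗ₘ κ) ≠ ∞ := ne_top_of_lt hI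
    set I := (mutualInfo ((gaussianReal m v) ⊗ₘ κ)).toReal with hIdef
    have hIle : I ≤ R.toReal + ε := by
      have := ENNReal.toReal_mono (by finiteness) hI.le
      rwa [ENNReal.toReal_add hR (by simp), ENNReal.toReal_ofReal hε.le] at this
    have hexp : Real.exp (-2 * (R.toReal + ε)) ≤ Real.exp (-2 * I) :=
      Real.exp_le_exp.2 (by linarith)
    constructor
    · have h1 := (EReal.coe_ennreal_le_coe_ennreal_iff.2
        (ofReal_le_lintegral_sq_sub hv hfst hfin)).trans hmse
      rw [EReal.coe_ennreal_ofReal, max_eq_left (by positivity), EReal.coe_le_coe_iff] at h1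
      refine le_trans ?_ h1
      gcongr
    · have h1 := (le_condEntropy_repLaw (b := b) hv hfst hfin haw).trans hent
      rw [EReal.coe_le_coe_iff] at h1
      refine le_trans ?_ h1
      have := hApos (R.toReal + ε)
      gcongr
  have hlim : ∀ {F : ℝ → ℝ} {c : ℝ}, ContinuousAt F 0 → (∀ ε > 0, F ε ≤ c) → F 0 ≤ c := by
    intro F c hF h
    refine le_of_tendsto (hF.tendsto.mono_left nhdsWithin_le_nhds : Tendsto F (𝓝[>] 0) _) ?_
    filter_upwards [self_mem_nhdsWithin] with ε hε using h ε hε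
  constructor
  · have := hlim (F := fun ε => v * Real.exp (-2 * (R.toReal + ε))) (by fun_prop)
      fun ε hε => (key ε hε).1
    simpa using this
  · have := hlim (F := fun ε => 1 / 2 * (Real.log (2 * Real.pi
      * (a ^ 2 * (v * Real.exp (-2 * (R.toReal + ε))) + w)) + 1)) (by
        have h := (hApos (R.toReal + 0)).ne'
        have h' := Real.pi_pos.ne'
        fun_prop (disch := positivity)) fun ε hε => (key ε hε).2
    simpa using this

/-- A Gaussian test channel with the right rate meets every constraint pair in the rate region. -/
theorem meets_of_testChannel [IsProbabilityMeasure η] (hv : v ≠ 0) (haw : a ≠ 0 ∨ w ≠ 0)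
    (hg : Measurable g) {κ : Kernel ℝ β} [IsMarkovKernel κ]
    (hκ : (gaussianReal m v) ⊗ₘ κ = testChannel η g t)
    (hfin : mutualInfo (testChannel η g t) ≠ ∞) {p : ℝ × ℝ}
    (hp : p ∈ rateRegion (noisyGraph (gaussianReal m v) (fun x => a * x + b) w)
      (mutualInfo (testChannel η g t))) :
    Meets (noisyGraph (gaussianReal m v) (fun x => a * x + b) w) (κ.map g) p.1 p.2 := by
  have hv' : (0 : ℝ) < v := by positivity
  have hfst : (testChannel η g t).fst = gaussianReal m v := by
    rw [← hκ, Measure.fst_compProd]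
  have ht : t ≠ 0 := by
    rintro rfl
    exact hfin (mutualInfo_testChannel_zero hg hv hfst)
  have ht' : (0 : ℝ) < t := by positivity
  obtain ⟨h1, h2⟩ := bounds_of_mem_rateRegion hv haw hfin hp
  rw [(mutualInfo_testChannel hg hv ht hfst).2] at h1 h2
  have : IsMarkovKernel (κ.map g) := Kernel.IsMarkovKernel.map κ hg
  have hmap : (gaussianReal m v) ⊗ₘ (κ.map g) = testChannel (η.map g) id t := by
    rw [Measure.compProd_map hg, hκ, testChannel_map hg]
  have : IsProbabilityMeasure (η.map g) := Measure.isProbabilityMeasure_map hg.aemeasurable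
  refine ⟨?_, ?_⟩
  · rw [mse, lawSourceRep_noisyGraph (by fun_prop), hmap, lintegral_sq_testChannel]
    rw [EReal.coe_nnreal_eq_coe_real, EReal.coe_le_coe_iff]
    exact h1
  · have hvar : NNReal.mk (a ^ 2) (sq_nonneg a) * t + w ≠ 0 := by
      intro h
      have h' : a ^ 2 * (t : ℝ) + w = 0 := by simpa using congrArg NNReal.toReal h
      have hw0 : (0 : ℝ) ≤ w := w.2
      rcases haw with ha | hw
      · have : 0 < a ^ 2 * (t : ℝ) := by positivity
        linarith
      · have h3 : (0 : ℝ) < w := by positivity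
        have : 0 ≤ a ^ 2 * (t : ℝ) := by positivity
        linarith
    rw [lawRepClass_noisyGraph, hmap, repLaw_testChannel,
      condEntropy_noisyGraph (by fun_prop) hvar, EReal.coe_le_coe_iff]
    exact h2

end TestChannel

/-! ### Reduction of jointly Gaussian laws to the model, and universality. -/

section GaussianModel

open Set Filter Topology InformationTheory
open scoped NNReal

/-- A jointly Gaussian pair is a Gaussian variable together with an affine image of it corrupted
by an independent Gaussian noise. -/
lemma exists_jointLaw_eq_noisyGraph {Ω : Type*} [MeasurableSpace Ω] {P : Measure Ω}
    [IsProbabilityMeasure P] {X S : Ω → ℝ} {μX μS : ℝ} {vX vS : ℝ≥0} (hvX : vX ≠ 0) (hvS : vS ≠ 0)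
    (hXS : HasGaussianLaw (fun ω => (X ω, S ω)) P) (hX : HasLaw X (gaussianReal μX vX) P)
    (hS : HasLaw S (gaussianReal μS vS) P) :
    ∃ (a b : ℝ) (w : ℝ≥0), (a ≠ 0 ∨ w ≠ 0) ∧
      jointLaw P X S = noisyGraph (gaussianReal μX vX) (fun x => a * x + b) w := by
  have hvX' : (0 : ℝ) < vX := by positivity
  have hX2 : MemLp X 2 P := hXS.fst.memLp_two
  have hS2 : MemLp S 2 P := hXS.snd.memLp_two
  have hvarX : Var[X; P] = vX := by rw [hX.variance_eq, variance_id_gaussianReal]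
  have hvarS : Var[S; P] = vS := by rw [hS.variance_eq, variance_id_gaussianReal]
  -- The regression coefficient: the residual `S - a X` is uncorrelated with `X`, hence independent
  -- of it by joint Gaussianity.
  set a := cov[X, S; P] / vX with ha
  set W : Ω → ℝ := fun ω => S ω - a * X ω with hW
  have hXW : HasGaussianLaw (fun ω => (X ω, W ω)) P := by
    have h := hXS.map_fun ((ContinuousLinearMap.fst ℝ ℝ ℝ).prod
      (ContinuousLinearMap.snd ℝ ℝ ℝ - a • ContinuousLinearMap.fst ℝ ℝ ℝ))
    simpa [hW] using h
  have hcov : cov[X, W; P] = 0 := by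
    rw [hW, covariance_fun_sub_right hX2 hS2 (hX2.const_mul a), covariance_const_mul_right,
      covariance_self hX2.aemeasurable, hvarX, ha]
    field_simp
    ring
  have hind := hXW.indepFun_of_covariance_eq_zero hcov
  rw [indepFun_iff_map_prod_eq_prod_map_map hX2.aemeasurable hXW.snd.aemeasurable, hX.map_eq,
    hXW.snd.map_eq_gaussianReal] at hind
  refine ⟨a, P[W], Var[W; P].toNNReal, ?_, ?_⟩
  -- If `a` and `w` both vanished, `S` would be its own residual, with variance zero.
  · by_contra! hcon
    have h1 : W = S := by ext ω; simp [hW, hcon.1]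
    rw [h1, hvarS, Real.toNNReal_coe] at hcon
    exact hvS hcon.2
  · have h1 : jointLaw P X S = (P.map fun ω => (X ω, W ω)).map fun q => (q.1, a * q.1 + q.2) := by
      rw [AEMeasurable.map_map_of_aemeasurable (by fun_prop) hXW.aemeasurable, jointLaw]
      congr 1
      ext ω <;> simp [hW]
    have h2 := Measure.map_prod_map (gaussianReal μX vX) (gaussianReal 0 Var[W; P].toNNReal)
      (f := id) (g := fun n => P[W] + n) measurable_id (by fun_prop)
    rw [gaussianReal_map_const_add, zero_add, Measure.map_id] at h2
    rw [h1, hind, h2, Measure.map_map (by fun_prop) (by fun_prop), noisyGraph]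
    congr 1
    ext q
    · rfl
    · simp; ring

/-- Every representation that is jointly Gaussian with a Gaussian source is a test channel, with
an affine backward map. -/
lemma exists_eq_testChannel {E : Type*} [NormedAddCommGroup E] [NormedSpace ℝ E]
    [FiniteDimensional ℝ E] [MeasurableSpace E] [BorelSpace E] {π : Measure (ℝ × E)} [IsGaussian π]
    {m : ℝ} {v : ℝ≥0} (hfst : π.fst = gaussianReal m v) :
    ∃ (ℓ : E →L[ℝ] ℝ) (t : ℝ≥0),
      π = testChannel π.snd (fun z => ℓ (z - ∫ w, w ∂π.snd) + m) t := by
  have : SecondCountableTopology E := by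
    have := FiniteDimensional.proper ℝ E
    infer_instance
  have : CompleteSpace E := FiniteDimensional.complete ℝ E
  set z₀ := ∫ w, w ∂π.snd with hz₀
  have hid : HasGaussianLaw (fun q : ℝ × E => (q.1, q.2)) π := IsGaussian.hasGaussianLaw_id
  have hX2 : MemLp (fun q : ℝ × E => q.1) 2 π := hid.fst.memLp_two
  have hZ2 : MemLp (fun q : ℝ × E => q.2) 2 π := hid.snd.memLp_two
  have hXmean : ∫ q, q.1 ∂π = m := by
    rw [integral_comp_fst_of_fst_eq hfst (f := fun x => x) measurable_id, integral_id_gaussianReal]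
  have hZmean : ∫ q, q.2 ∂π = z₀ := by
    rw [hz₀, Measure.snd, integral_map measurable_snd.aemeasurable (by fun_prop)]
  have hLm : ∀ L : E →L[ℝ] ℝ, MemLp (fun q : ℝ × E => L (q.2 - z₀)) 2 π := fun L =>
    L.comp_memLp' (hZ2.sub (memLp_const z₀))
  have hXm : MemLp (fun q : ℝ × E => q.1 - m) 2 π := hX2.sub (memLp_const m)
  -- The best linear predictor of `X - m` is the orthogonal projection in `L²` onto the
  -- finite-dimensional space of functionals of the centred `Z`. `T` need not be injective, so a
  -- degenerate covariance of `Z` is allowed.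
  let T : (E →L[ℝ] ℝ) →ₗ[ℝ] Lp ℝ 2 π :=
    { toFun := fun L => (hLm L).toLp _
      map_add' := fun L L' => by
        rw [← MemLp.toLp_add]; rfl
      map_smul' := fun c L => by
        rw [RingHom.id_apply, ← MemLp.toLp_const_smul]; rfl }
  obtain ⟨ℓ, hℓ⟩ : ∃ ℓ : E →L[ℝ] ℝ, ∀ L : E →L[ℝ] ℝ,
      ∫ q, (q.1 - m - ℓ (q.2 - z₀)) * L (q.2 - z₀) ∂π = 0 := by
    have hmem := Submodule.starProjection_apply_mem (LinearMap.range T) (hXm.toLp _)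
    obtain ⟨ℓ, hℓ⟩ := hmem
    refine ⟨ℓ, fun L => ?_⟩
    have horth := Submodule.starProjection_inner_eq_zero (K := LinearMap.range T) (hXm.toLp _)
      (T L) ⟨L, rfl⟩
    rw [← hℓ, L2.inner_def] at horth
    rw [← horth]
    refine integral_congr_ae ?_
    have e1 : (hXm.toLp _ - T ℓ : Lp ℝ 2 π) =ᵐ[π] fun q => q.1 - m - ℓ (q.2 - z₀) := by
      have := Lp.coeFn_sub (hXm.toLp _) (T ℓ)
      filter_upwards [this, hXm.coeFn_toLp, (hLm ℓ).coeFn_toLp] with q h1 h2 h3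
      rw [h1, Pi.sub_apply, h2]
      congr 1
    filter_upwards [e1, (hLm L).coeFn_toLp] with q h1 h2
    change _ = inner ℝ _ ((hLm L).toLp _ q)
    rw [h1, h2]
    simp [mul_comm]
  set W : ℝ × E → ℝ := fun q => q.1 - ℓ q.2 with hW
  have hWZ : HasGaussianLaw (fun q : ℝ × E => (W q, q.2)) π :=
    hid.map_fun ((ContinuousLinearMap.fst ℝ ℝ E - ℓ.comp (ContinuousLinearMap.snd ℝ ℝ E)).prod
      (ContinuousLinearMap.snd ℝ ℝ E))
  have hZint : Integrable (fun q : ℝ × E => q.2) π := hZ2.integrable (by norm_num)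
  have hLmean : ∀ L : E →L[ℝ] ℝ, ∫ q, L q.2 ∂π = L z₀ := fun L => by
    rw [← hZmean, L.integral_comp_comm hZint]
  have hWmean : ∫ q, W q ∂π = m - ℓ z₀ := by
    rw [hW, integral_sub (hX2.integrable (by norm_num)) (ℓ.integrable_comp hZint), hXmean,
      hLmean]
  -- Orthogonality of the residual to every functional of `Z` is vanishing covariance, which means
  -- independence for a jointly Gaussian pair.
  have hind : IndepFun W (fun q : ℝ × E => q.2) π := by
    refine hWZ.indepFun_of_covariance_strongDual fun L₁ L₂ => ?_
    have hL₁ : ∀ x, L₁ x = L₁ 1 * x := fun x => by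
      have := L₁.map_smul x 1
      simp only [smul_eq_mul, mul_one] at this
      rw [this, mul_comm]
    have e : (L₁ ∘ W) = fun q => L₁ 1 * W q := by ext q; exact hL₁ _
    rw [e, covariance_const_mul_left, covariance, hWmean]
    have e2 : ∫ q, (⇑L₂ ∘ fun q : ℝ × E => q.2) q ∂π = L₂ z₀ := hLmean L₂
    rw [e2]
    refine mul_eq_zero_of_right _ ?_
    rw [← hℓ L₂]
    refine integral_congr_ae (ae_of_all _ fun q => ?_)
    simp only [hW, Function.comp_apply, map_sub]
    ring
  rw [indepFun_iff_map_prod_eq_prod_map_map hWZ.fst.aemeasurable measurable_snd.aemeasurable,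
    hWZ.fst.map_eq_gaussianReal, hWmean] at hind
  refine ⟨ℓ, Var[W; π].toNNReal, ?_⟩
  set t := Var[W; π].toNNReal
  have h1 : π = (π.map fun q => (W q, q.2)).map fun q => (ℓ q.2 + q.1, q.2) := by
    rw [Measure.map_map (by fun_prop) (by fun_prop)]
    conv_lhs => rw [← Measure.map_id (μ := π)]
    congr 1
    ext q <;> simp [hW]
  have h2 := Measure.map_prod_map (gaussianReal 0 t) π.snd
    (f := fun n => (m - ℓ z₀) + n) (g := id) (by fun_prop) measurable_id
  rw [gaussianReal_map_const_add, zero_add, Measure.map_id] at h2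
  rw [testChannel_eq_map (by fun_prop)]
  conv_lhs => rw [h1, hind]
  change ((gaussianReal _ t).prod π.snd).map _ = _
  rw [h2, ← Measure.prod_swap, Measure.map_map (by fun_prop) (by fun_prop),
    Measure.map_map (by fun_prop) (by fun_prop)]
  congr 1
  ext q
  · simp; ring
  · simp

/-- For every finite rate there is a scalar test channel with this rate. -/
lemma exists_kernel_eq_testChannel (m : ℝ) {v : ℝ≥0} (hv : v ≠ 0) {R : ℝ≥0∞} (hR : R ≠ ∞) :
    ∃ (κ : Kernel ℝ ℝ) (η : Measure ℝ) (t : ℝ≥0), IsMarkovKernel κ ∧ IsProbabilityMeasure η ∧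
      (gaussianReal m v) ⊗ₘ κ = testChannel η id t ∧ mutualInfo (testChannel η id t) = R := by
  have hv' : (0 : ℝ) < v := by positivity
  set t : ℝ≥0 := v * (Real.exp (-2 * R.toReal)).toNNReal with ht
  have htv : (t : ℝ) = v * Real.exp (-2 * R.toReal) := by
    rw [ht, NNReal.coe_mul, Real.coe_toNNReal _ (Real.exp_pos _).le]
  have ht0 : t ≠ 0 := by
    have : (0 : ℝ) < t := by rw [htv]; positivity
    exact_mod_cast this.ne'
  have htle : t ≤ v := by
    rw [← NNReal.coe_le_coe, htv]
    exact mul_le_of_le_one_right hv'.le (Real.exp_le_one_iff.2 (by simp))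
  -- The variance `v - t` restores that of `X` once the noise is added; truncated subtraction is
  -- harmless by `htle`. The forward channel comes from disintegration.
  set η := gaussianReal m (v - t) with hη
  have hfst : (testChannel η id t).fst = gaussianReal m v := by
    have h := gaussianReal_conv_gaussianReal (m₁ := m) (m₂ := 0) (v₁ := v - t) (v₂ := t)
    rw [add_zero, tsub_add_cancel_of_le htle, Measure.conv] at h
    rw [testChannel_eq_map measurable_id, Measure.fst_map_prodMk (by fun_prop), ← h]
    rfl
  have := isProbabilityMeasure_testChannel (t := t) (η := η) measurable_id
  obtain ⟨hfin, hval⟩ := mutualInfo_testChannel measurable_id hv ht0 hfst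
  refine ⟨(testChannel η id t).condKernel, η, t, inferInstance, inferInstance, ?_, ?_⟩
  · rw [← hfst]
    exact Measure.disintegrate _ _
  · rw [htv] at hval
    have h := Real.exp_injective (mul_left_cancel₀ hv'.ne' hval)
    exact (ENNReal.toReal_eq_toReal_iff' hfin hR).1 (by linarith)

lemma rate_le_of_mem_repRegion {β : Type*} [MeasurableSpace β] {ν : Measure (ℝ × ℝ)}
    [IsProbabilityMeasure ν] {κ : Kernel ℝ β} [IsMarkovKernel κ] {p : ℝ × ℝ}
    (hp : p ∈ repRegion ν κ) : rate ν p.1 p.2 ≤ mutualInfo (lawSourceRep ν κ) := by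
  obtain ⟨δ, hδ, hmeets⟩ := hp
  exact (iInf_le_of_le (δ ∘ₖ κ) (iInf_le_of_le (inferInstance : IsMarkovKernel (δ ∘ₖ κ))
    (iInf_le_of_le hmeets le_rfl))).trans
    (mutualInfo_comp_le ν.fst κ δ)

lemma mem_repRegion_of_meets_map {β : Type*} [MeasurableSpace β] {ν : Measure (ℝ × ℝ)}
    {κ : Kernel ℝ β} {g : β → ℝ} (hg : Measurable g) {p : ℝ × ℝ}
    (hp : Meets ν (κ.map g) p.1 p.2) : p ∈ repRegion ν κ :=
  ⟨Kernel.deterministic g hg, inferInstance, by rwa [Kernel.deterministic_comp_eq_map]⟩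

lemma supRate_le_universalRate {ν : Measure (ℝ × ℝ)} [IsProbabilityMeasure ν]
    (Θ : Set (ℝ × ℝ)) : supRate ν Θ ≤ universalRate ν Θ :=
  le_iInf fun _ => le_iInf fun _ => le_iInf fun _ => le_iInf fun _ => le_iInf fun hΘ =>
    iSup₂_le fun _ hp => rate_le_of_mem_repRegion (hΘ hp)

lemma subset_rateRegion_supRate (ν : Measure (ℝ × ℝ)) (Θ : Set (ℝ × ℝ)) :
    Θ ⊆ rateRegion ν (supRate ν Θ) :=
  fun p hp => le_iSup₂ (f := fun (p : ℝ × ℝ) (_ : p ∈ Θ) => rate ν p.1 p.2) p hp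

theorem universalRate_eq_supRate {m a b : ℝ} {v w : ℝ≥0} (hv : v ≠ 0) (haw : a ≠ 0 ∨ w ≠ 0)
    [IsProbabilityMeasure (noisyGraph (gaussianReal m v) (fun x => a * x + b) w)]
    (Θ : Set (ℝ × ℝ)) :
    universalRate (noisyGraph (gaussianReal m v) (fun x => a * x + b) w) Θ
      = supRate (noisyGraph (gaussianReal m v) (fun x => a * x + b) w) Θ := by
  refine le_antisymm ?_ (supRate_le_universalRate Θ)
  set ν := noisyGraph (gaussianReal m v) (fun x => a * x + b) w
  by_cases hR : supRate ν Θ = ∞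
  · rw [hR]; exact le_top
  -- One scalar test channel at the supremal rate, with the identity as decoder, meets all pairs of
  -- `Θ` at once.
  obtain ⟨κ, η, t, hκ, hη, hlaw, hI⟩ := exists_kernel_eq_testChannel m hv hR
  have hsub : Θ ⊆ repRegion ν κ := fun p hp => by
    refine mem_repRegion_of_meets_map measurable_id
      (meets_of_testChannel hv haw measurable_id hlaw (by rwa [hI]) ?_)
    rw [hI]
    exact subset_rateRegion_supRate ν Θ hp
  refine iInf₂_le_of_le ℝ inferInstance (iInf₂_le_of_le κ hκ (iInf_le_of_le hsub ?_))
  rw [lawSourceRep_noisyGraph (by fun_prop), hlaw, hI]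

end GaussianModel

end RDC

/-! ### The main theorem. -/

theorem mainTheorem1 {Ω : Type*} [MeasurableSpace Ω] (P : Measure Ω) [IsProbabilityMeasure P]
    (X S : Ω → ℝ) (μX μS σX σS θ₁ : ℝ) (hσX : 0 < σX) (hσS : 0 < σS)
    (hXS : HasGaussianLaw (fun ω => (X ω, S ω)) P)
    (hX : HasLaw X (gaussianReal μX (σX ^ 2).toNNReal) P)
    (hS : HasLaw S (gaussianReal μS (σS ^ 2).toNNReal) P)
    (hθ : cov[X, S; P] = θ₁)
    (Θ : Set (ℝ × ℝ)) (hΘ : Θ.Nonempty) :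
    -- no rate penalty, as an equality in `[0, ∞]` and as a difference when the supremum is finite
    RDC.universalRate (RDC.jointLaw P X S) Θ = RDC.supRate (RDC.jointLaw P X S) Θ ∧
    (RDC.supRate (RDC.jointLaw P X S) Θ ≠ ∞ →
      RDC.ratePenalty (RDC.jointLaw P X S) Θ = 0 ∧
      -- every representation that is jointly Gaussian with `X` and has the right rate is universal
      ∀ (E : Type*) [NormedAddCommGroup E] [NormedSpace ℝ E] [FiniteDimensional ℝ E]
        [MeasurableSpace E] [BorelSpace E] (κ : Kernel ℝ E) [IsMarkovKernel κ],
        IsGaussian (RDC.lawSourceRep (RDC.jointLaw P X S) κ) →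
        RDC.mutualInfo (RDC.lawSourceRep (RDC.jointLaw P X S) κ) =
          RDC.supRate (RDC.jointLaw P X S) Θ →
        Θ ⊆ RDC.repRegion (RDC.jointLaw P X S) κ ∧
        RDC.repRegion (RDC.jointLaw P X S) κ =
          RDC.rateRegion (RDC.jointLaw P X S)
            (RDC.mutualInfo (RDC.lawSourceRep (RDC.jointLaw P X S) κ)) ∧
        -- the whole region is reached by decoders `z ↦ ℓ (z - E[Z]) + E[X]` with `ℓ` linear
        ∀ p ∈ RDC.rateRegion (RDC.jointLaw P X S)
            (RDC.mutualInfo (RDC.lawSourceRep (RDC.jointLaw P X S) κ)),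
          ∃ ℓ : E →L[ℝ] ℝ,
            RDC.Meets (RDC.jointLaw P X S)
              (κ.map (fun z => ℓ (z - ∫ w, w ∂(RDC.lawSourceRep (RDC.jointLaw P X S) κ).snd) + μX))
              p.1 p.2) := by
  have hvX : (σX ^ 2).toNNReal ≠ 0 := by
    rw [ne_eq, Real.toNNReal_eq_zero, not_le]; positivity
  have hvS : (σS ^ 2).toNNReal ≠ 0 := by
    rw [ne_eq, Real.toNNReal_eq_zero, not_le]; positivity
  have : IsProbabilityMeasure (RDC.jointLaw P X S) :=
    Measure.isProbabilityMeasure_map hXS.aemeasurable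
  obtain ⟨a, b, w, haw, hν⟩ := RDC.exists_jointLaw_eq_noisyGraph hvX hvS hXS hX hS
  rw [hν] at this ⊢
  set ν := RDC.noisyGraph (gaussianReal μX (σX ^ 2).toNNReal) (fun x => a * x + b) w with hνdef
  have huniv : RDC.universalRate ν Θ = RDC.supRate ν Θ :=
    RDC.universalRate_eq_supRate hvX haw Θ
  refine ⟨huniv, fun hfin => ⟨?_, ?_⟩⟩
  · rw [RDC.ratePenalty, huniv]
    exact EReal.sub_self (by simpa using hfin) (by simp)
  intro E _ _ _ _ _ κ _ hgauss hI
  have hsrc : RDC.lawSourceRep ν κ = (gaussianReal μX (σX ^ 2).toNNReal) ⊗ₘ κ :=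
    RDC.lawSourceRep_noisyGraph (by fun_prop) κ
  have hfst : (RDC.lawSourceRep ν κ).fst = gaussianReal μX (σX ^ 2).toNNReal := by
    rw [hsrc, Measure.fst_compProd]
  obtain ⟨ℓ, t, hℓ⟩ := RDC.exists_eq_testChannel hfst
  have hprob : IsProbabilityMeasure (RDC.lawSourceRep ν κ).snd := by
    rw [hsrc]; infer_instance
  set z₀ := ∫ w, w ∂(RDC.lawSourceRep ν κ).snd with hz₀
  have hg : Measurable fun z : E => ℓ (z - z₀) + μX := by fun_prop
  have hmeets : ∀ p ∈ RDC.rateRegion ν (RDC.mutualInfo (RDC.lawSourceRep ν κ)),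
      RDC.Meets ν (κ.map fun z => ℓ (z - z₀) + μX) p.1 p.2 := by
    intro p hp
    rw [hℓ] at hp
    exact RDC.meets_of_testChannel hvX haw hg (hsrc.symm.trans hℓ)
      (by rw [← hℓ, hI]; exact hfin) hp
  have hregion : RDC.repRegion ν κ
      = RDC.rateRegion ν (RDC.mutualInfo (RDC.lawSourceRep ν κ)) :=
    Set.Subset.antisymm (fun p hp => RDC.rate_le_of_mem_repRegion hp)
      fun p hp => RDC.mem_repRegion_of_meets_map hg (hmeets p hp)
  -- The same `ℓ` serves every pair, because its decoder reaches the corner of the quadrant.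
  refine ⟨?_, hregion, fun p hp => ⟨ℓ, hmeets p hp⟩⟩
  rw [hregion, hI]
  exact RDC.subset_rateRegion_supRate ν Θ
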